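/- Let $d\ge 3$ and $N\ge 3$ be integers. A homogeneous polynomial $F\in\mathbb{C}[x_1,\dots,x_N]$ of degree $d$ is called smooth if its partial derivatives have no common zero in $\mathbb{C}^N$ other than the origin; $V(F)\subset\mathbb{P}^{N-1}$ is the hypersurface it defines. A linear automorphism of a hypersurface $V(F)\subset\mathbb{P}^{N-1}$ is an element of $\mathrm{PGL}(N,\mathbb{C})$ mapping $V(F)$ onto itself, and its order is its order in $\mathrm{PGL}(N,\mathbb{C})$. For $k\ge 1$ the polynomial $x_1^{d-1}x_2+x_2^{d-1}x_3+\cdots+x_{k-1}^{d-1}x_k+x_k^{d-1}x_1$ is said to be of type $K_k$ and $x_1^{d-1}x_2+\cdots+x_{k-1}^{d-1}x_k+x_k^d$ of type $T_k$ (both are $x_1^d$ for $k=1$); a simple polynomial of degree $d$ is a sum of finitely many polynomials of these types (its components), all of degree $d$, in disjoint sets of variables. Theorem. Let $n$ be the order of a linear automorphism of a smooth hypersurface of degree $d$ in $\mathbb{P}^{N-1}$. Then $n$ is also the order of a linear automorphism of a hypersurface in $\mathbb{P}^{N-1}$ defined by a simple polynomial of degree $d$ in the $N$ variables $x_1,\dots,x_N$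 (all of which occur) that has at most one component of type $T_b$ with $b\ge 2$. Explicitly, $n$ divides at least one of the following integers: (i) $\frac{|1-(1-d)^N|}{d}$; (ii) $(d-1)^{N-1}$; (iii) $|1-(1-d)^a|$ for some integer $1\le a\le N-1$; (iv) $\mathrm{lcm}(|1-(1-d)^{a_1}|,\dots,|1-(1-d)^{a_t}|)$ for some integers $t\ge 2$ and $1\le a_1<\cdots<a_t$ with $\sum_{i=1}^t a_i\le N$; (v) $\mathrm{lcm}(|1-(1-d)^{a_1}|,\dots,|1-(1-d)^{a_t}|,(d-1)^{b-1})$ for some integers $t\ge 1$, $1\le a_1<\cdots<a_t$ and $b\ge 2$ with $\sum_{i=1}^t a_i+b\le N$. -/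

import Mathlib

open scoped LinearAlgebra.Projectivization Pointwise

noncomputable section

namespace SimpleHypersurface

/-- The hypersurface `V(F)` in `ℙ^{N-1}` (as a set of complex points) of a homogeneous form `F` in
`N` variables: the lines on which `F` vanishes. -/
def V {N : ℕ} (F : MvPolynomial (Fin N) ℂ) : Set (ℙ ℂ (Fin N → ℂ)) :=
  {p | ∀ v ∈ p.submodule, MvPolynomial.eval v F = 0}

/-- `F` is a smooth homogeneous polynomial of degree `d`: the only common zero of its partial
derivatives is the origin. -/
def IsSmoothForm {N : ℕ} (d : ℕ) (F : MvPolynomial (Fin N) ℂ) : Prop :=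
  F.IsHomogeneous d ∧
    ∀ v : Fin N → ℂ, (∀ i, MvPolynomial.eval v (MvPolynomial.pderiv i F) = 0) → v = 0

/-- The group `Lin(V(F))` of linear automorphisms of `V(F)`: the elements of `PGL(N, ℂ)` mapping
`V(F)` onto itself. -/
def Lin {N : ℕ} (F : MvPolynomial (Fin N) ℂ) : Subgroup (Matrix.ProjGenLinGroup (Fin N) ℂ) :=
  MulAction.stabilizer (Matrix.ProjGenLinGroup (Fin N) ℂ) (V F)

/-- The polynomial `x₁^{d-1} x₂ + x₂^{d-1} x₃ + ⋯ + x_k^{d-1} x₁` of type `K_k`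
(`finRotate k` is the cyclic successor on `Fin k`). -/
def typeK (d k : ℕ) : MvPolynomial (Fin k) ℂ :=
  ∑ i : Fin k, MvPolynomial.X i ^ (d - 1) * MvPolynomial.X (finRotate k i)

/-- The polynomial `x₁^{d-1} x₂ + ⋯ + x_{k-1}^{d-1} x_k + x_k^d` of type `T_k`. -/
def typeT (d k : ℕ) : MvPolynomial (Fin k) ℂ :=
  ∑ i : Fin k,
    if h : i.1 + 1 < k then MvPolynomial.X i ^ (d - 1) * MvPolynomial.X ⟨i.1 + 1, h⟩
    else MvPolynomial.X i ^ d

/-- `F` is a simple polynomial of degree `d` in the variables `x₁, …, x_N`, of type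
`K_{a₁} ⊕ ⋯ ⊕ K_{a_t} ⊕ T_{b₁} ⊕ ⋯ ⊕ T_{b_s}`. The bijection `e` distributes the `N` variables
among the components, in disjoint groups. -/
def IsSimpleOfType {N t s : ℕ} (d : ℕ) (a : Fin t → ℕ) (b : Fin s → ℕ)
    (F : MvPolynomial (Fin N) ℂ) : Prop :=
  (∀ i, 1 ≤ a i) ∧ (∀ j, 1 ≤ b j) ∧
    ∃ e : ((i : Fin t) × Fin (a i)) ⊕ ((j : Fin s) × Fin (b j)) ≃ Fin N,
      F = ∑ i, MvPolynomial.rename (fun k => e (Sum.inl ⟨i, k⟩)) (typeK d (a i)) +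
          ∑ j, MvPolynomial.rename (fun k => e (Sum.inr ⟨j, k⟩)) (typeT d (b j))

/-- `F` is a simple polynomial of degree `d` in `N` variables having at most one component of
type `T_b` with `b ≥ 2`. -/
def IsSimpleWithAtMostOneT {N : ℕ} (d : ℕ) (F : MvPolynomial (Fin N) ℂ) : Prop :=
  ∃ (t s : ℕ) (a : Fin t → ℕ) (b : Fin s → ℕ), IsSimpleOfType d a b F ∧
    ∀ j j' : Fin s, 2 ≤ b j → 2 ≤ b j' → j = j'

/-- The natural number `|1 - (1 - d)^a|`. -/
def kleinNumber (d a : ℕ) : ℕ := (1 - (1 - (d : ℤ)) ^ a).natAbs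

end SimpleHypersurface

end

/-!
Let `g` be a linear automorphism of a smooth hypersurface `F = 0` of degree `d`.

A smooth form in at least two variables is squarefree, so by the Nullstellensatz a suitable lift
`A` of `g` fixes `F` itself (`IsSmoothForm.exists_lift`). The lift is diagonalizable. Indeed the
chain rule expresses the gradient of `F` at `B v`, for a matrix `B` fixing `F`, through `B⁻¹` and
the gradient at `v`; as the gradient of a smooth form grows with exponent `d - 1 ≥ 2`, the entries
of all such matrices, in particular of all powers of `A` and `A⁻¹`, are bounded
(`IsSmoothForm.exists_entry_bound`), which excludes nontrivial Jordan blocks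
(`exists_basis_eigenvectors`).

For a diagonal symmetry with weights `μ i`, the decisive fact is a counting principle
(`IsSmoothForm.card_weight_le`): for every homomorphism `φ` on the weights and every value `c`,
at least as many indices `j` satisfy `φ (μ j) = c ^ (1 - d)` as satisfy `φ (μ i) = c`. Otherwise
too few partial derivatives would survive on a coordinate subspace, and by Krull's height theorem
they would have a common zero there, a singular point.

The rest is dynamics of `f x = x ^ (1 - d)` on the finite set of weights. Applied to the iterates of
`f`, which are homomorphisms, the principle says that the number of weights over a point does not
decrease along `f`, hence is constant along cycles. A point on a cycle of length `a` is killed by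
the Klein number `|1 - (1 - d) ^ a|`, and if a weight needs `k` steps to enter its cycle, this
contributes the factor `(d - 1) ^ k`. The counts over the cycle of a weight with maximal `k`
increase strictly with each of the `k` steps (`exists_periodic_card_bound`), and this extra room is
what makes the lengths of the cycles fit into `N` (`exists_isMaximalOrder_pow_eq`).

Conversely each of the numbers obtained divides the order of a diagonal automorphism of a simple
polynomial with at most one component `T_b`, `b ≥ 2` (`IsMaximalOrder.exists_isDiagonalOrder`), and
a power of that automorphism has the order of `g`.
-/

namespace SimpleHypersurface

open MvPolynomial
open Function hiding eval

/-! ### Common zeros of few polynomials -/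

/-- Fewer polynomials than variables, all vanishing at the origin, have a common zero other than
the origin. Otherwise every maximal ideal of the polynomial ring, being the ideal of a point,
would be minimal over translates of the given polynomials, so that Krull's height theorem would
bound the dimension of the ring by their number. -/
theorem exists_common_zero {σ ι : Type*} [Fintype σ] [Fintype ι]
    (p : ι → MvPolynomial σ ℂ) (hp : ∀ i, eval 0 (p i) = 0)
    (hcard : Fintype.card ι < Fintype.card σ) :
    ∃ v : σ → ℂ, v ≠ 0 ∧ ∀ i, eval v (p i) = 0 := by
  by_contra! hcon
  have hdim : ringKrullDim (MvPolynomial σ ℂ) ≤ ((Fintype.card ι : ℕ∞) : WithBot ℕ∞) := by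
    rw [ringKrullDim_le_iff_isMaximal_height_le]
    intro M hM
    obtain ⟨a, rfl⟩ := eq_vanishingIdeal_singleton_of_isMaximal ℂ hM
    set q : ι → MvPolynomial σ ℂ := fun i => aeval (fun s => X s - C (a s)) (p i) with hq
    have hqe : ∀ (x : σ → ℂ) (i : ι), eval x (q i) = eval (x - a) (p i) := by
      intro x i
      have : (eval x).comp (aeval (fun s => X s - C (a s)) :
          MvPolynomial σ ℂ →ₐ[ℂ] MvPolynomial σ ℂ).toRingHom = eval (x - a) := by
        ext s <;> simp
      exact congrArg (fun f : MvPolynomial σ ℂ →+* ℂ => f (p i)) this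
    have hz : zeroLocus ℂ (Ideal.span (Set.range q)) = {a} := by
      rw [zeroLocus_span]
      ext x
      simp only [Set.mem_range, forall_exists_index, forall_apply_eq_imp_iff, Set.mem_ofPred_eq,
        Set.mem_singleton_iff, aeval_eq_eval]
      constructor
      · intro h
        by_contra hxa
        obtain ⟨i, hi⟩ := hcon (x - a) (sub_ne_zero.mpr hxa)
        exact hi (by rw [← hqe]; exact h i)
      · rintro rfl i
        have := hqe x i
        rw [sub_self, hp] at this
        exact this
    have hrad := vanishingIdeal_zeroLocus_eq_radical (K := ℂ) (Ideal.span (Set.range q))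
    rw [hz] at hrad
    have hmin : vanishingIdeal ℂ {a} ∈ (Ideal.span (Set.range q)).minimalPrimes := by
      refine ⟨⟨inferInstance, ?_⟩, fun J hJ _ => ?_⟩
      · rw [hrad]; exact Ideal.le_radical
      · rw [hrad]; exact hJ.1.radical_le_iff.mpr hJ.2
    have h1 := Ideal.height_le_card_of_mem_minimalPrimes_span (Set.finite_range q) hmin
    have h2 : (Set.range q).ncard ≤ Fintype.card ι := by
      rw [← Set.image_univ, ← Nat.card_eq_fintype_card, ← Set.ncard_univ]
      exact Set.ncard_image_le
    exact_mod_cast h1.trans (by exact_mod_cast h2)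
  have hge := ringKrullDim_add_natCard_le_ringKrullDim_mvPolynomial (R := ℂ) σ
  rw [ringKrullDim_eq_zero_of_field, zero_add, Nat.card_eq_fintype_card] at hge
  have := hge.trans hdim
  have h3 : Fintype.card σ ≤ Fintype.card ι := by exact_mod_cast this
  omega

/-! ### Equations of a smooth hypersurface -/

/-- A polynomial in at least two variables with no zero outside the origin is a nonzero constant,
because it divides powers of two different variables. -/
theorem isUnit_of_forall_eval_ne_zero {σ : Type*} [Finite σ] {G : MvPolynomial σ ℂ}
    {i j : σ} (hij : i ≠ j) (h : ∀ v : σ → ℂ, eval v G = 0 → v = 0) : IsUnit G := by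
  have hdvd : ∀ k : σ, ∃ n : ℕ, G ∣ X k ^ n := by
    intro k
    have : (X k : MvPolynomial σ ℂ) ∈ (Ideal.span {G}).radical := by
      rw [← vanishingIdeal_zeroLocus_eq_radical (K := ℂ), zeroLocus_span]
      intro x hx
      have := h x (by simpa using hx)
      simp [this]
    obtain ⟨n, hn⟩ := this
    exact ⟨n, Ideal.mem_span_singleton.mp hn⟩
  obtain ⟨n, hn⟩ := hdvd i
  obtain ⟨m, hm⟩ := hdvd j
  have hrel : IsRelPrime (X i : MvPolynomial σ ℂ) (X j) := by
    rw [(X_prime (R := ℂ) (i := i)).irreducible.isRelPrime_iff_not_dvd, X_dvd_X]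
    simp [hij]
  exact (hrel.pow (m := n) (n := m)) hn hm

/-- A smooth form in at least two variables is squarefree: the zeros of a double factor are
singular. -/
theorem IsSmoothForm.squarefree {N d : ℕ} {F : MvPolynomial (Fin N) ℂ} (hF : IsSmoothForm d F)
    (hN : 2 ≤ N) : Squarefree F := by
  rintro G ⟨H, rfl⟩
  refine isUnit_of_forall_eval_ne_zero (i := (⟨0, by omega⟩ : Fin N)) (j := ⟨1, by omega⟩)
    (by simp) fun v hv => hF.2 v fun i => ?_
  simp [hv]

/-- The polynomial `F(A x)`. -/
noncomputable def substMatrix {N : ℕ} (A : Matrix (Fin N) (Fin N) ℂ) (F : MvPolynomial (Fin N) ℂ) :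
    MvPolynomial (Fin N) ℂ :=
  aeval (fun i => ∑ j, C (A i j) * X j) F

theorem eval_substMatrix {N : ℕ} (A : Matrix (Fin N) (Fin N) ℂ) (F : MvPolynomial (Fin N) ℂ)
    (v : Fin N → ℂ) : eval v (substMatrix A F) = eval (A.mulVec v) F := by
  have : (eval v).comp (aeval (fun i => ∑ j, C (A i j) * X j) :
      MvPolynomial (Fin N) ℂ →ₐ[ℂ] MvPolynomial (Fin N) ℂ).toRingHom = eval (A.mulVec v) := by
    ext s <;> simp [Matrix.mulVec, dotProduct]
  exact congrArg (fun f : MvPolynomial (Fin N) ℂ →+* ℂ => f F) this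

theorem isHomogeneous_substMatrix {N d : ℕ} {F : MvPolynomial (Fin N) ℂ}
    (hF : F.IsHomogeneous d) (A : Matrix (Fin N) (Fin N) ℂ) :
    (substMatrix A F).IsHomogeneous d := by
  unfold substMatrix
  have := hF.aeval (fun i => ∑ j, C (A i j) * X j) (n := 1) fun i =>
    IsHomogeneous.sum _ _ _ fun j _ => by
      simpa using (isHomogeneous_C (Fin N) (A i j)).mul (isHomogeneous_X ℂ j)
  simpa using this

/-- Two forms of the same degree with the same zeros are proportional, if one of them is
squarefree. -/
theorem exists_eq_const_mul {σ : Type*} [Finite σ] {d : ℕ} {F G : MvPolynomial σ ℂ}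
    (hF : F.IsHomogeneous d) (hG : G.IsHomogeneous d) (hsq : Squarefree F) (hG0 : G ≠ 0)
    (hz : ∀ v, eval v F = 0 → eval v G = 0) : ∃ c : ℂ, c ≠ 0 ∧ G = C c * F := by
  have hmem : G ∈ (Ideal.span {F}).radical := by
    rw [← vanishingIdeal_zeroLocus_eq_radical (K := ℂ), zeroLocus_span]
    intro x hx
    exact hz x (by simpa using hx)
  obtain ⟨n, hn⟩ := hmem
  have hF0 : F ≠ 0 := hsq.ne_zero
  obtain ⟨H, rfl⟩ : F ∣ G := hsq.isRadical n G (Ideal.mem_span_singleton.mp hn)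
  have hH0 : H ≠ 0 := right_ne_zero_of_mul hG0
  have hdeg : H.totalDegree = 0 := by
    have h1 := totalDegree_mul_of_isDomain hF0 hH0
    rw [hG.totalDegree hG0, hF.totalDegree hF0] at h1
    omega
  refine ⟨coeff 0 H, ?_, ?_⟩
  · intro h
    rw [totalDegree_eq_zero_iff_eq_C.mp hdeg, h] at hH0
    simp at hH0
  · rw [← totalDegree_eq_zero_iff_eq_C.mp hdeg, mul_comm]

/-! ### Linear symmetries of a smooth form are bounded -/

theorem hasDerivAt_eval_add_smul {σ : Type*} [Fintype σ] (F : MvPolynomial σ ℂ)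
    (v w : σ → ℂ) :
    HasDerivAt (fun t : ℂ => eval (v + t • w) F) (∑ i, w i * eval v (pderiv i F)) 0 := by
  classical
  induction F using MvPolynomial.induction_on with
  | C a => simpa using hasDerivAt_const (0 : ℂ) a
  | add p q hp hq =>
    simp only [map_add, mul_add, Finset.sum_add_distrib]
    exact hp.add hq
  | mul_X p k hp =>
    have hX : HasDerivAt (fun t : ℂ => v k + t * w k) (w k) 0 := by
      simpa using ((hasDerivAt_id (0 : ℂ)).mul_const (w k)).const_add (v k)
    have := hp.mul hX
    simp only [zero_smul, add_zero, zero_mul] at this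
    have hfun : (fun t : ℂ => eval (v + t • w) (p * X k)) =
        (fun t => eval (v + t • w) p) * fun t => v k + t * w k := by
      funext t; simp
    rw [hfun]
    refine this.congr_deriv ?_
    simp only [pderiv_mul, pderiv_X, map_add, map_mul, eval_X, mul_add, Finset.sum_add_distrib,
      Finset.sum_mul, Pi.single_apply]
    congr 1
    · exact Finset.sum_congr rfl fun i _ => by ring
    · simp [apply_ite, mul_comm]

/-- The chain rule for `F(B v)`, in the form of an identity of directional derivatives. -/
theorem sum_mulVec_mul_pderiv {N : ℕ} {F G : MvPolynomial (Fin N) ℂ}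
    {B : Matrix (Fin N) (Fin N) ℂ} (hB : ∀ v, eval (B.mulVec v) F = eval v G)
    (v w : Fin N → ℂ) :
    ∑ i, B.mulVec w i * eval (B.mulVec v) (pderiv i F) = ∑ i, w i * eval v (pderiv i G) := by
  have h1 := hasDerivAt_eval_add_smul F (B.mulVec v) (B.mulVec w)
  have h2 := hasDerivAt_eval_add_smul G v w
  have h3 : (fun t : ℂ => eval (B.mulVec v + t • B.mulVec w) F) =
      fun t : ℂ => eval (v + t • w) G := by
    funext t
    rw [← hB, Matrix.mulVec_add, Matrix.mulVec_smul]
  rw [h3] at h1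
  exact h1.unique h2

theorem eval_smul_of_isHomogeneous {σ : Type*} {k : ℕ} {p : MvPolynomial σ ℂ}
    (hp : p.IsHomogeneous k) (t : ℂ) (v : σ → ℂ) : eval (t • v) p = t ^ k * eval v p := by
  rw [eval_eq, eval_eq, Finset.mul_sum]
  refine Finset.sum_congr rfl fun α hα => ?_
  have hdeg : ∑ i ∈ α.support, α i = k := by
    have := hp (mem_support_iff.mp hα)
    simpa [Finsupp.weight_apply, Finsupp.sum] using this
  simp only [Pi.smul_apply, smul_eq_mul, mul_pow, Finset.prod_mul_distrib,
    Finset.prod_pow_eq_pow_sum, hdeg]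
  ring

/-- The gradient of a smooth form of degree `d` grows at least like `‖u‖ ^ (d - 1)`. -/
theorem IsSmoothForm.exists_le_sum_norm_pderiv {N d : ℕ} {F : MvPolynomial (Fin N) ℂ}
    (hF : IsSmoothForm d F) (hd : 2 ≤ d) :
    ∃ c : ℝ, 0 < c ∧ ∀ u : Fin N → ℂ, c * ‖u‖ ^ (d - 1) ≤ ∑ i, ‖eval u (pderiv i F)‖ := by
  have hcont : Continuous fun u : Fin N → ℂ => ∑ i, ‖eval u (pderiv i F)‖ :=
    continuous_finsetSum _ fun i _ => (MvPolynomial.continuous_eval _).norm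
  have hhom : ∀ (t : ℂ) (u : Fin N → ℂ), ∑ i, ‖eval (t • u) (pderiv i F)‖ =
      ‖t‖ ^ (d - 1) * ∑ i, ‖eval u (pderiv i F)‖ := by
    intro t u
    simp [eval_smul_of_isHomogeneous (hF.1.pderiv), Finset.mul_sum]
  have hnn : ∀ u : Fin N → ℂ, 0 ≤ ∑ i, ‖eval u (pderiv i F)‖ :=
    fun u => Finset.sum_nonneg fun i _ => norm_nonneg _
  obtain ⟨c, hc, hmin⟩ : ∃ c : ℝ, 0 < c ∧ ∀ u : Fin N → ℂ, ‖u‖ = 1 →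
      c ≤ ∑ i, ‖eval u (pderiv i F)‖ := by
    rcases (Metric.sphere (0 : Fin N → ℂ) 1).eq_empty_or_nonempty with h | h
    · refine ⟨1, one_pos, fun u hu => ?_⟩
      have : u ∈ Metric.sphere (0 : Fin N → ℂ) 1 := by simpa using hu
      rw [h] at this
      exact this.elim
    · obtain ⟨u, hu, hmin⟩ := (isCompact_sphere (0 : Fin N → ℂ) 1).exists_isMinOn h
        hcont.continuousOn
      refine ⟨_, (hnn u).lt_of_ne fun h0 => ?_, fun w hw => hmin (by simpa using hw)⟩
      rw [eq_comm, Finset.sum_eq_zero_iff_of_nonneg fun i _ => norm_nonneg _] at h0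
      have := hF.2 u fun i => norm_eq_zero.mp (h0 i (Finset.mem_univ i))
      simp [this] at hu
  refine ⟨c, hc, fun u => ?_⟩
  by_cases hu : u = 0
  · subst hu
    simpa [show d - 1 ≠ 0 by omega] using hnn 0
  · have hu' : ‖u‖ ≠ 0 := norm_ne_zero_iff.mpr hu
    have h1 := hmin (((‖u‖⁻¹ : ℝ) : ℂ) • u) (by simp [norm_smul, hu'])
    rw [hhom] at h1
    simp only [Complex.ofReal_inv, norm_inv, Complex.norm_real, norm_norm] at h1
    calc c * ‖u‖ ^ (d - 1) ≤ ‖u‖⁻¹ ^ (d - 1) * (∑ i, ‖eval u (pderiv i F)‖) * ‖u‖ ^ (d - 1) := by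
          gcongr
      _ = (‖u‖⁻¹ * ‖u‖) ^ (d - 1) * ∑ i, ‖eval u (pderiv i F)‖ := by rw [mul_pow]; ring
      _ = _ := by rw [inv_mul_cancel₀ hu', one_pow, one_mul]

/-- If `F ∘ B = F`, then the gradient of `F` at `B v` is the transpose of `B⁻¹` applied to the
gradient at `v`. Since gradients of `F` grow with exponent `d - 1 ≥ 2`, the entries of `B` and of
`B⁻¹` bound each other's powers, hence are bounded. -/
theorem IsSmoothForm.exists_entry_bound {N d : ℕ} {F : MvPolynomial (Fin N) ℂ}
    (hF : IsSmoothForm d F) (hd : 3 ≤ d) :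
    ∃ K : ℝ, ∀ B B' : Matrix (Fin N) (Fin N) ℂ, B * B' = 1 →
      (∀ v, eval (B.mulVec v) F = eval v F) → (∀ i j, ‖B i j‖ ≤ K) ∧ ∀ i j, ‖B' i j‖ ≤ K := by
  obtain ⟨c, hc, hlow⟩ := hF.exists_le_sum_norm_pderiv (by omega)
  obtain ⟨C, hC⟩ : ∃ C : ℝ, ∀ p : Fin N × Fin N,
      ‖eval (Pi.single p.2 1) (pderiv p.1 F)‖ ≤ C := by
    obtain ⟨C, hC⟩ := (Set.finite_range fun p : Fin N × Fin N =>
      ‖eval (Pi.single p.2 1) (pderiv p.1 F)‖).bddAbove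
    exact ⟨C, fun p => hC ⟨p, rfl⟩⟩
  have key : ∀ B B' : Matrix (Fin N) (Fin N) ℂ, B * B' = 1 →
      (∀ v, eval (B.mulVec v) F = eval v F) → ∀ x : ℝ, (∀ i j, ‖B' i j‖ ≤ x) →
      (∃ i j, ‖B i j‖ = x) → x ≤ max 1 (N * (N * (C / c))) := by
    rintro B B' hBB hB x hx ⟨i₀, j₀, hij⟩
    have hx0 : 0 ≤ x := hij ▸ norm_nonneg _
    have hgrad : ∀ i, ‖eval (B.mulVec (Pi.single j₀ 1)) (pderiv i F)‖ ≤ N * (x * C) := by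
      intro i
      have h1 := sum_mulVec_mul_pderiv hB (Pi.single j₀ 1) (B'.mulVec (Pi.single i 1))
      rw [Matrix.mulVec_mulVec, hBB, Matrix.one_mulVec] at h1
      simp only [Pi.single_apply, ite_mul, one_mul, zero_mul, Finset.sum_ite_eq',
        Finset.mem_univ, if_true] at h1
      rw [h1]
      calc _ ≤ ∑ k : Fin N, x * C := by
            refine (norm_sum_le _ _).trans (Finset.sum_le_sum fun k _ => ?_)
            rw [norm_mul]
            refine mul_le_mul ?_ (hC (k, j₀)) (norm_nonneg _) hx0
            simpa using hx k i
        _ = _ := by simp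
    have h2 : c * x ^ (d - 1) ≤ N * (N * (x * C)) := by
      calc c * x ^ (d - 1) ≤ c * ‖B.mulVec (Pi.single j₀ 1)‖ ^ (d - 1) := by
            gcongr
            rw [← hij]
            simpa using norm_le_pi_norm (B.mulVec (Pi.single j₀ 1)) i₀
        _ ≤ _ := hlow _
        _ ≤ ∑ i : Fin N, N * (x * C) := Finset.sum_le_sum fun i _ => hgrad i
        _ = _ := by simp
    rcases le_total x 1 with h | h
    · exact h.trans (le_max_left _ _)
    · refine le_trans ?_ (le_max_right _ _)
      have h3 : x ^ 2 ≤ x ^ (d - 1) := pow_le_pow_right₀ h (by omega)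
      have h4 : c * x * x ≤ N * (N * C) * x := by nlinarith
      have h5 := le_of_mul_le_mul_right h4 (by linarith)
      rw [← mul_div_assoc, ← mul_div_assoc, le_div_iff₀ hc]
      linarith
  refine ⟨max 1 (N * (N * (C / c))), fun B B' hBB hB => ?_⟩
  rcases isEmpty_or_nonempty (Fin N) with hN | hN
  · exact ⟨fun i => hN.elim i, fun i => hN.elim i⟩
  have hBB' : B' * B = 1 := mul_eq_one_comm.mp hBB
  have hB' : ∀ v, eval (B'.mulVec v) F = eval v F := fun v => by
    rw [← hB, Matrix.mulVec_mulVec, hBB, Matrix.one_mulVec]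
  obtain ⟨⟨i, j⟩, hij⟩ := Finite.exists_max fun p : Fin N × Fin N => ‖B p.1 p.2‖
  obtain ⟨⟨i', j'⟩, hij'⟩ := Finite.exists_max fun p : Fin N × Fin N => ‖B' p.1 p.2‖
  rcases le_total ‖B i j‖ ‖B' i' j'‖ with h | h
  · have := key B' B hBB' hB' _ (fun k l => (hij (k, l)).trans h) ⟨i', j', rfl⟩
    exact ⟨fun k l => ((hij (k, l)).trans h).trans this, fun k l => (hij' (k, l)).trans this⟩
  · have := key B B' hBB hB _ (fun k l => (hij' (k, l)).trans h) ⟨i, j, rfl⟩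
    exact ⟨fun k l => (hij (k, l)).trans this, fun k l => ((hij' (k, l)).trans h).trans this⟩

/-! ### Diagonalization -/

/-- An invertible complex matrix all of whose integer powers are bounded has a basis of
eigenvectors: a nontrivial Jordan block would make the powers grow linearly. -/
theorem exists_basis_eigenvectors {N : ℕ} {A A' : Matrix (Fin N) (Fin N) ℂ} (hAA : A' * A = 1)
    {K : ℝ} (hK : ∀ (m : ℕ) i j, ‖(A ^ m) i j‖ ≤ K) (hK' : ∀ (m : ℕ) i j, ‖(A' ^ m) i j‖ ≤ K) :
    ∃ (b : Module.Basis (Fin N) ℂ (Fin N → ℂ)) (μ : Fin N → ℂ),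
      ∀ i, A.mulVec (b i) = μ i • b i := by
  have hbound : ∀ B : Matrix (Fin N) (Fin N) ℂ, (∀ i j, ‖B i j‖ ≤ K) → ∀ v,
      ‖B.mulVec v‖ ≤ N * (K * ‖v‖) := by
    intro B hB v
    rcases isEmpty_or_nonempty (Fin N) with hN | ⟨⟨i₀⟩⟩
    · rw [Subsingleton.elim (B.mulVec v) 0]
      obtain rfl : N = 0 := by
        rcases N with _ | n
        · rfl
        · exact hN.elim 0
      simp
    have hK0 : 0 ≤ K := (norm_nonneg _).trans (hB i₀ i₀)
    rw [pi_norm_le_iff_of_nonneg (by positivity)]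
    intro i
    calc ‖∑ k, B i k * v k‖ ≤ ∑ k : Fin N, K * ‖v‖ := by
          refine (norm_sum_le _ _).trans (Finset.sum_le_sum fun k _ => ?_)
          rw [norm_mul]
          exact mul_le_mul (hB i k) (norm_le_pi_norm v k) (norm_nonneg _) hK0
      _ = _ := by simp
  set f : Module.End ℂ (Fin N → ℂ) := Matrix.toLin' A with hf
  have hsq : ∀ (μ : ℂ) (v : Fin N → ℂ), (f - μ • 1) ((f - μ • 1) v) = 0 → (f - μ • 1) v = 0 := by
    intro μ v hv
    by_contra hw0
    set w := (f - μ • 1) v with hw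
    have hfw : A.mulVec w = μ • w := by
      simpa [hf, sub_eq_zero] using hv
    have hfv : A.mulVec v = μ • v + w := by
      simp [hw, hf]
    have hpw : ∀ m : ℕ, (A ^ m).mulVec w = μ ^ m • w := by
      intro m
      induction m with
      | zero => simp
      | succ m ih => rw [pow_succ', ← Matrix.mulVec_mulVec, ih, Matrix.mulVec_smul, hfw, smul_smul,
          pow_succ]
    have hpv : ∀ m : ℕ, μ • (A ^ m).mulVec v = μ ^ m • (μ • v + (m : ℂ) • w) := by
      intro m
      induction m with
      | zero => simp
      | succ m ih =>
        rw [pow_succ', ← Matrix.mulVec_mulVec, ← Matrix.mulVec_smul, ih, Matrix.mulVec_smul,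
          Matrix.mulVec_add, Matrix.mulVec_smul, Matrix.mulVec_smul, hfw, hfv]
        push_cast
        module
    have hμ : μ ≠ 0 := by
      rintro rfl
      have : (A' * A).mulVec w = 0 := by rw [← Matrix.mulVec_mulVec, hfw]; simp
      rw [hAA, Matrix.one_mulVec] at this
      exact hw0 this
    have hinv : ∀ m : ℕ, (A' ^ m).mulVec w = (μ⁻¹) ^ m • w := by
      intro m
      have h1 : (A' ^ m).mulVec ((A ^ m).mulVec w) = w := by
        rw [Matrix.mulVec_mulVec, pow_mul_pow_eq_one m hAA, Matrix.one_mulVec]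
      rw [hpw, Matrix.mulVec_smul] at h1
      rw [inv_pow, eq_inv_smul_iff₀ (pow_ne_zero m hμ), h1]
    have hwpos : 0 < ‖w‖ := norm_pos_iff.mpr hw0
    have hμinv : ∀ m : ℕ, ‖(μ⁻¹) ^ m‖ ≤ N * K := by
      intro m
      have h1 := hbound _ (hK' m) w
      rw [hinv, norm_smul] at h1
      exact le_of_mul_le_mul_right (by linarith) hwpos
    have hlin : ∀ m : ℕ, (m : ℝ) * ‖w‖ ≤ (N * K) * (‖μ‖ * (N * (K * ‖v‖))) + ‖μ‖ * ‖v‖ := by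
      intro m
      have h1 : (m : ℂ) • w = (μ⁻¹) ^ m • (μ • (A ^ m).mulVec v) - μ • v := by
        rw [hpv, smul_smul, ← mul_pow, inv_mul_cancel₀ hμ, one_pow, one_smul]
        abel
      have h2 : (m : ℝ) * ‖w‖ = ‖(m : ℂ) • w‖ := by simp [norm_smul]
      rw [h2, h1]
      refine (norm_sub_le ((μ⁻¹) ^ m • (μ • (A ^ m).mulVec v)) (μ • v)).trans (add_le_add ?_ (norm_smul μ v).le)
      rw [norm_smul, norm_smul]
      have h3 := hbound _ (hK m) v
      exact mul_le_mul (hμinv m) (mul_le_mul_of_nonneg_left h3 (norm_nonneg _)) (by positivity)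
        ((norm_nonneg _).trans (hμinv m))
    obtain ⟨m, hm⟩ := exists_nat_gt (((N * K) * (‖μ‖ * (N * (K * ‖v‖))) + ‖μ‖ * ‖v‖) / ‖w‖)
    rw [div_lt_iff₀ hwpos] at hm
    exact absurd (hlin m) (not_le.mpr hm)
  have hpow : ∀ (μ : ℂ) (k : ℕ) (v : Fin N → ℂ), ((f - μ • 1) ^ (k + 1)) v = 0 →
      (f - μ • 1) v = 0 := by
    intro μ k
    induction k with
    | zero => intro v hv; simpa using hv
    | succ k ih =>
      intro v hv
      refine hsq μ v (ih _ ?_)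
      rw [pow_succ] at hv
      exact hv
  have hspan : ⊤ ≤ Submodule.span ℂ {v : Fin N → ℂ | ∃ μ : ℂ, A.mulVec v = μ • v} := by
    rw [← f.iSup_maxGenEigenspace_eq_top]
    refine iSup_le fun μ v hv => Submodule.subset_span ⟨μ, ?_⟩
    obtain ⟨k, hk⟩ := (Module.End.mem_maxGenEigenspace f μ v).mp hv
    have h0 : ((f - μ • 1) ^ (k + 1)) v = 0 := by
      rw [pow_succ', Module.End.mul_apply, hk, map_zero]
    simpa [hf, sub_eq_zero] using hpow μ k v h0
  let b := Module.Basis.ofSpan hspan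
  have hfin := Module.finite_of_finrank_pos (R := ℂ) (M := Fin N → ℂ)
  let e := b.indexEquiv (Pi.basisFun ℂ (Fin N))
  have hb : ∀ i, ∃ μ : ℂ, A.mulVec (b.reindex e i) = μ • b.reindex e i := by
    intro i
    have : b (e.symm i) ∈ {v : Fin N → ℂ | ∃ μ : ℂ, A.mulVec v = μ • v} :=
      Module.Basis.ofSpan_subset hspan ⟨_, rfl⟩
    simpa using this
  choose μ hμ using hb
  exact ⟨b.reindex e, μ, hμ⟩

/-! ### Counting eigenvalues of a diagonal symmetry -/

/-- Smoothness is invariant under invertible linear substitutions. -/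
theorem isSmoothForm_substMatrix {N d : ℕ} {F : MvPolynomial (Fin N) ℂ} (hF : IsSmoothForm d F)
    {P P' : Matrix (Fin N) (Fin N) ℂ} (hP : P * P' = 1) :
    IsSmoothForm d (substMatrix P F) := by
  refine ⟨isHomogeneous_substMatrix hF.1 P, fun v hv => ?_⟩
  have h1 : P.mulVec v = 0 := hF.2 _ fun i => by
    have h2 := sum_mulVec_mul_pderiv (fun v => (eval_substMatrix P F v).symm) v
      (P'.mulVec (Pi.single i 1))
    rw [Matrix.mulVec_mulVec, hP, Matrix.one_mulVec] at h2
    simpa [Pi.single_apply, hv] using h2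
  rw [← Matrix.one_mulVec v, ← mul_eq_one_comm.mp hP, ← Matrix.mulVec_mulVec, h1,
    Matrix.mulVec_zero]

/-- Every monomial of a form fixed by a diagonal substitution has weight one. -/
theorem prod_pow_eq_one_of_mem_support {σ : Type*} [Fintype σ] {F : MvPolynomial σ ℂ}
    {μ : σ → ℂˣ} (hinv : ∀ v : σ → ℂ, eval (fun i => (μ i : ℂ) * v i) F = eval v F)
    {α : σ →₀ ℕ} (hα : α ∈ F.support) : ∏ i, μ i ^ α i = 1 := by
  classical
  have hG : F = ∑ β ∈ F.support, monomial β (coeff β F * ∏ i, (μ i : ℂ) ^ β i) := by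
    refine MvPolynomial.funext fun v => ?_
    rw [← hinv, eval_eq', map_sum]
    refine Finset.sum_congr rfl fun β _ => ?_
    rw [eval_monomial, Finsupp.prod_fintype _ _ fun i => pow_zero _]
    simp only [mul_pow, Finset.prod_mul_distrib]
    ring
  have h1 := congrArg (coeff α) hG
  simp only [coeff_sum, coeff_monomial, Finset.sum_ite_eq', hα, if_true] at h1
  have h2 : ∏ i, (μ i : ℂ) ^ α i = 1 := by
    have h0 := mem_support_iff.mp hα
    exact mul_left_cancel₀ h0 (by rw [← h1, mul_one])
  exact Units.ext (by push_cast; exact h2)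

/-- The counting principle behind the theorem. Let `I` be the set of variables whose weight is
sent to `c` by the homomorphism `φ`. On the coordinate subspace of `I` only those partial
derivatives `∂F/∂x_j` can be nonzero for which the weight of `x_j` is sent to `c ^ (1 - d)`.
If there were fewer of them than variables in `I`, they would have a common zero there, which would
be a singular point of `F`. -/
theorem IsSmoothForm.card_weight_le {N d : ℕ} {F : MvPolynomial (Fin N) ℂ}
    (hF : IsSmoothForm d F) (hd : 2 ≤ d) {μ : Fin N → ℂˣ}
    (hinv : ∀ v : Fin N → ℂ, eval (fun i => (μ i : ℂ) * v i) F = eval v F)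
    {Q : Type*} [CommGroup Q] [DecidableEq Q] (φ : ℂˣ →* Q) (c : Q) :
    (Finset.univ.filter fun i => φ (μ i) = c).card ≤
      (Finset.univ.filter fun j => φ (μ j) = (c ^ (d - 1))⁻¹).card := by
  by_contra! hlt
  set I := Finset.univ.filter fun i => φ (μ i) = c with hI
  set J := Finset.univ.filter fun j => φ (μ j) = (c ^ (d - 1))⁻¹ with hJ
  let p : J → MvPolynomial I ℂ := fun j =>
    aeval (fun i => if h : i ∈ I then X ⟨i, h⟩ else 0) (pderiv j.1 F)
  let ext : (I → ℂ) → Fin N → ℂ := fun v i => if h : i ∈ I then v ⟨i, h⟩ else 0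
  have hp : ∀ (v : I → ℂ) (j : J), eval v (p j) = eval (ext v) (pderiv j.1 F) := by
    intro v j
    have : (eval v).comp (aeval (fun i => if h : i ∈ I then X ⟨i, h⟩ else 0) :
        MvPolynomial (Fin N) ℂ →ₐ[ℂ] MvPolynomial I ℂ).toRingHom = eval (ext v) := by
      ext i
      · simp
      · by_cases h : i ∈ I <;> simp [ext, h]
    exact congrArg (fun f : MvPolynomial (Fin N) ℂ →+* ℂ => f (pderiv j.1 F)) this
  have hp0 : ∀ j, eval 0 (p j) = 0 := by
    intro j
    rw [hp, show ext 0 = (0 : ℂ) • (0 : Fin N → ℂ) by funext i; simp [ext],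
      eval_smul_of_isHomogeneous hF.1.pderiv, zero_pow (by omega), zero_mul]
  obtain ⟨v, hv0, hv⟩ := exists_common_zero p hp0 (by simpa using hlt)
  refine hv0 (funext fun i => ?_)
  have hext : ext v = 0 := by
    refine hF.2 _ fun j => ?_
    by_cases hj : j ∈ J
    · rw [← hp v ⟨j, hj⟩, hv]
    · rw [eval_eq']
      refine Finset.sum_eq_zero fun β hβ => ?_
      by_contra hne
      apply hj
      have hβI : ∀ i, β i ≠ 0 → φ (μ i) = c := by
        intro i hi
        by_contra hiI
        apply hne
        have : ext v i = 0 := by simp [ext, hI, hiI]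
        rw [Finset.prod_eq_zero (Finset.mem_univ i) (by rw [this, zero_pow hi]), mul_zero]
      have hdeg : ∑ i, β i = d - 1 := by
        have h1 := (hF.1.pderiv (i := j)) (mem_support_iff.mp hβ)
        simpa [Finsupp.weight_apply, Finsupp.sum_fintype] using h1
      have hmem : β + Finsupp.single j 1 ∈ F.support := by
        rw [mem_support_iff, coeff_pderiv] at hβ
        exact mem_support_iff.mpr (left_ne_zero_of_mul hβ)
      have hw := congrArg φ (prod_pow_eq_one_of_mem_support hinv hmem)
      have h3 : ∏ i, φ (μ i) ^ β i = c ^ (d - 1) := by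
        rw [← hdeg, ← Finset.prod_pow_eq_pow_sum]
        refine Finset.prod_congr rfl fun i _ => ?_
        by_cases hi : β i = 0
        · simp [hi]
        · rw [hβI i hi]
      simp only [Finsupp.add_apply, pow_add, Finset.prod_mul_distrib, map_mul, map_prod, map_pow,
        map_one, h3, Finsupp.single_apply, pow_ite, pow_one, pow_zero, Finset.prod_ite_eq,
        Finset.mem_univ, if_true] at hw
      simp only [hJ, Finset.mem_filter, Finset.mem_univ, true_and]
      exact eq_inv_of_mul_eq_one_right hw
  have := congrFun hext i.1
  simpa [ext] using this

/-! ### Dynamics of the eigenvalues -/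

/-- The number of indices `i` such that `μ i` reaches `x` after exactly `j` steps of `f`. -/
def hitCount {X ι : Type*} [DecidableEq X] [Fintype ι] (f : X → X) (μ : ι → X) (j : ℕ) (x : X) :
    ℕ :=
  (Finset.univ.filter fun i => f^[j] (μ i) = x).card

section Dynamics

theorem mem_periodicPts_iterate {X : Type*} {f : X → X} {p : X} (hp : p ∈ periodicPts f) (n : ℕ) :
    f^[n] p ∈ periodicPts f := by
  obtain ⟨m, hm, h⟩ := hp
  exact ⟨m, hm, h.apply_iterate n⟩

variable {X ι : Type*} [DecidableEq X] [Fintype ι] {f : X → X} {μ : ι → X}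

theorem hitCount_iterate_of_periodic (h : ∀ j x, hitCount f μ j x ≤ hitCount f μ j (f x)) {p : X}
    (hp : p ∈ periodicPts f) (j n : ℕ) : hitCount f μ j (f^[n] p) = hitCount f μ j p := by
  have hmono : ∀ n x, hitCount f μ j x ≤ hitCount f μ j (f^[n] x) := by
    intro n
    induction n with
    | zero => intro x; exact le_rfl
    | succ n ih => intro x; rw [iterate_succ_apply']; exact (ih x).trans (h j _)
  refine le_antisymm ?_ (hmono n p)
  have hpos := minimalPeriod_pos_of_mem_periodicPts hp
  refine (hmono (minimalPeriod f p * n - n) _).trans_eq ?_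
  rw [← iterate_add_apply, Nat.sub_add_cancel (Nat.le_mul_of_pos_left n hpos)]
  rw [(isPeriodicPt_minimalPeriod f p).mul_const n]

theorem exists_eq_iterate (h : ∀ j x, hitCount f μ j x ≤ hitCount f μ j (f x)) (i : ι) (n : ℕ) :
    ∃ i', μ i' = f^[n] (μ i) := by
  induction n with
  | zero => exact ⟨i, rfl⟩
  | succ n ih =>
    obtain ⟨i', hi'⟩ := ih
    have h1 := h 0 (μ i')
    have h2 : 0 < hitCount f μ 0 (μ i') :=
      Finset.card_pos.mpr ⟨i', Finset.mem_filter.mpr ⟨Finset.mem_univ _, rfl⟩⟩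
    obtain ⟨i'', hi''⟩ := Finset.card_pos.mp (h2.trans_le h1)
    refine ⟨i'', ?_⟩
    rw [iterate_succ_apply', ← hi']
    exact (Finset.mem_filter.mp hi'').2

theorem card_image_iterate_range_minimalPeriod (p : X) :
    ((Finset.range (minimalPeriod f p)).image fun n => f^[n] p).card = minimalPeriod f p := by
  rw [Finset.card_image_of_injOn, Finset.card_range]
  intro m hm n hn hmn
  exact iterate_injOn_Iio_minimalPeriod (by simpa using hm) (by simpa using hn) hmn

/-- If the fibre counts of all iterates do not decrease along `f`, then after `k` steps
all points `μ i` are periodic, and a nonzero minimal `k` costs `k` extra points over every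
point of some cycle: along that cycle the counts are constant, and for a point `p` of it they
increase strictly with the number of steps up to `k`. -/
theorem exists_periodic_card_bound (h : ∀ j x, hitCount f μ j x ≤ hitCount f μ j (f x)) :
    ∃ (P : Finset X) (k : ℕ), (∀ p ∈ P, p ∈ periodicPts f) ∧ (∀ p ∈ P, ∀ n, f^[n] p ∈ P) ∧
      (∀ i, ∃ p ∈ P, f^[k] (μ i) = f^[k] p) ∧ P.card ≤ Fintype.card ι ∧
      (k ≠ 0 → ∃ p ∈ P, P.card + k * minimalPeriod f p ≤ Fintype.card ι) := by
  classical
  have hev : ∀ i, ∃ k, f^[k] (μ i) ∈ periodicPts f := by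
    intro i
    choose s hs using exists_eq_iterate h i
    obtain ⟨m, n, hmn, hsmn⟩ := Finite.exists_ne_map_eq_of_infinite s
    have heq : f^[m] (μ i) = f^[n] (μ i) := by rw [← hs, ← hs, hsmn]
    wlog hlt : m < n generalizing m n
    · exact this n m hmn.symm hsmn.symm heq.symm (by omega)
    refine ⟨m, n - m, by omega, ?_⟩
    rw [IsPeriodicPt, IsFixedPt, ← iterate_add_apply, Nat.sub_add_cancel hlt.le, heq]
  have hex : ∃ k, ∀ i, f^[k] (μ i) ∈ periodicPts f := by
    choose s hs using hev
    refine ⟨Finset.univ.sup s, fun i => ?_⟩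
    have hle : s i ≤ Finset.univ.sup s := Finset.le_sup (Finset.mem_univ i)
    rw [← Nat.sub_add_cancel hle, iterate_add_apply]
    exact mem_periodicPts_iterate (hs i) _
  set k := Nat.find hex with hk
  have hkspec : ∀ i, f^[k] (μ i) ∈ periodicPts f := Nat.find_spec hex
  set P : Finset X := (Finset.univ.image μ).filter fun x => x ∈ periodicPts f with hP
  have hPper : ∀ p ∈ P, p ∈ periodicPts f := fun p hp => (Finset.mem_filter.mp hp).2
  have hPiter : ∀ i n, f^[n] (μ i) ∈ periodicPts f → f^[n] (μ i) ∈ P := by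
    intro i n hn
    obtain ⟨i', hi'⟩ := exists_eq_iterate h i n
    exact Finset.mem_filter.mpr ⟨Finset.mem_image.mpr ⟨i', Finset.mem_univ _, hi'⟩, hn⟩
  have hPst : ∀ p ∈ P, ∀ n, f^[n] p ∈ P := by
    intro p hp n
    obtain ⟨i, -, rfl⟩ := Finset.mem_image.mp (Finset.mem_filter.mp hp).1
    exact hPiter i n (mem_periodicPts_iterate (hPper _ hp) n)
  have hpre : ∀ p ∈ P, ∀ n, ∃ p' ∈ P, f^[n] p' = p := by
    intro p hp n
    have hpos := minimalPeriod_pos_of_mem_periodicPts (hPper p hp)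
    refine ⟨f^[minimalPeriod f p * n - n] p, hPst p hp _, ?_⟩
    rw [← iterate_add_apply, Nat.add_sub_cancel' (Nat.le_mul_of_pos_left n hpos)]
    exact (isPeriodicPt_minimalPeriod f p).mul_const n
  have hcard : Fintype.card ι = ∑ p ∈ P, hitCount f μ k p := by
    rw [← Finset.card_univ, Finset.card_eq_sum_card_fiberwise (f := fun i => f^[k] (μ i)) (t := P)]
    · rfl
    · intro i _
      exact hPiter i k (hkspec i)
  have hone : ∀ p ∈ P, ∀ j, 1 ≤ hitCount f μ j p := by
    intro p hp j
    obtain ⟨p', hp', rfl⟩ := hpre p hp j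
    obtain ⟨i, -, rfl⟩ := Finset.mem_image.mp (Finset.mem_filter.mp hp').1
    exact Finset.card_pos.mpr ⟨i, Finset.mem_filter.mpr ⟨Finset.mem_univ _, rfl⟩⟩
  refine ⟨P, k, hPper, hPst, fun i => ?_, ?_, fun hk0 => ?_⟩
  · obtain ⟨p', hp', h'⟩ := hpre _ (hPiter i k (hkspec i)) k
    exact ⟨p', hp', h'.symm⟩
  · rw [hcard, Finset.card_eq_sum_ones]
    exact Finset.sum_le_sum fun p hp => hone p hp k
  · have hnot := Nat.find_min hex (m := k - 1) (by omega)
    push Not at hnot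
    obtain ⟨i₀, hi₀⟩ := hnot
    set p₀ := f^[k] (μ i₀) with hp₀
    have hp₀P : p₀ ∈ P := hPiter i₀ k (hkspec i₀)
    have hgrow : ∀ j, j ≤ k → j + 1 ≤ hitCount f μ j p₀ := by
      intro j
      induction j with
      | zero => intro _; exact hone p₀ hp₀P 0
      | succ j ih =>
        intro hj
        refine (Nat.succ_le_succ (ih (by omega))).trans ?_
        obtain ⟨p₁, hp₁P, hp₁⟩ := hpre p₀ hp₀P 1
        have h1 := hitCount_iterate_of_periodic h (hPper p₁ hp₁P) j 1
        rw [hp₁] at h1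
        rw [h1]
        refine Finset.card_lt_card ⟨fun i hi => ?_, fun hsub => ?_⟩
        · simp only [Finset.mem_filter, Finset.mem_univ, true_and] at hi ⊢
          rw [iterate_succ_apply', hi]
          exact hp₁
        · obtain ⟨i, hi⟩ := exists_eq_iterate h i₀ (k - (j + 1))
          have hmem : f^[j + 1] (μ i) = p₀ := by
            rw [hi, ← iterate_add_apply, Nat.add_sub_cancel' hj]
          have h2 := hsub (Finset.mem_filter.mpr ⟨Finset.mem_univ i, hmem⟩)
          simp only [Finset.mem_filter, Finset.mem_univ, true_and] at h2
          rw [hi, ← iterate_add_apply, show j + (k - (j + 1)) = k - 1 by omega] at h2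
          exact hi₀ (h2 ▸ hPper p₁ hp₁P)
    refine ⟨p₀, hp₀P, ?_⟩
    set O := (Finset.range (minimalPeriod f p₀)).image fun n => f^[n] p₀ with hO
    have hOP : O ⊆ P := by
      intro x hx
      obtain ⟨n, -, rfl⟩ := Finset.mem_image.mp hx
      exact hPst p₀ hp₀P n
    have hOcard : O.card = minimalPeriod f p₀ := card_image_iterate_range_minimalPeriod p₀
    calc P.card + k * minimalPeriod f p₀
        = ∑ p ∈ P, (1 + if p ∈ O then k else 0) := by
          rw [Finset.sum_add_distrib, ← Finset.sum_filter, Finset.filter_mem_eq_inter,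
            Finset.inter_eq_right.mpr hOP, Finset.sum_const, Finset.sum_const, hOcard]
          simp [mul_comm]
      _ ≤ ∑ p ∈ P, hitCount f μ k p := by
          refine Finset.sum_le_sum fun p hp => ?_
          split_ifs with hpO
          · obtain ⟨n, -, rfl⟩ := Finset.mem_image.mp hpO
            rw [hitCount_iterate_of_periodic h (hPper _ hp₀P)]
            have := hgrow k le_rfl
            omega
          · exact hone p hp k
      _ = _ := hcard.symm

/-- Cycles of different lengths are disjoint, so the sum of the different lengths is at most the
number of periodic points. -/
theorem sum_image_minimalPeriod_le {P : Finset X} (hst : ∀ p ∈ P, ∀ n, f^[n] p ∈ P) :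
    ∑ a ∈ P.image (minimalPeriod f), a ≤ P.card := by
  rw [Finset.card_eq_sum_card_image (minimalPeriod f) P]
  refine Finset.sum_le_sum fun a ha => ?_
  obtain ⟨p, hp, rfl⟩ := Finset.mem_image.mp ha
  rcases Nat.eq_zero_or_pos (minimalPeriod f p) with h0 | hpos
  · rw [h0]; exact Nat.zero_le _
  rw [← card_image_iterate_range_minimalPeriod p]
  refine Finset.card_le_card fun x hx => ?_
  obtain ⟨n, -, rfl⟩ := Finset.mem_image.mp hx
  refine Finset.mem_filter.mpr ⟨hst p hp n, ?_⟩
  rw [card_image_iterate_range_minimalPeriod p]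
  exact minimalPeriod_apply_iterate (minimalPeriod_pos_iff_mem_periodicPts.mp hpos) n

end Dynamics

/-! ### The possible orders -/

/-- The numbers of which the order of a linear automorphism of a smooth hypersurface of degree `d`
in `ℙ^{N-1}` is a divisor. -/
def IsMaximalOrder (d N X : ℕ) : Prop :=
  X = kleinNumber d N / d ∨
    X = (d - 1) ^ (N - 1) ∨
    (∃ a : ℕ, 1 ≤ a ∧ a ≤ N - 1 ∧ X = kleinNumber d a) ∨
    (∃ (t : ℕ) (a : Fin t → ℕ), 2 ≤ t ∧ StrictMono a ∧ (∀ i, 1 ≤ a i) ∧ ∑ i, a i ≤ N ∧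
      X = Finset.univ.lcm fun i => kleinNumber d (a i)) ∨
    (∃ (t : ℕ) (a : Fin t → ℕ) (b : ℕ), 1 ≤ t ∧ StrictMono a ∧ (∀ i, 1 ≤ a i) ∧ 2 ≤ b ∧
      (∑ i, a i) + b ≤ N ∧
      X = Nat.lcm (Finset.univ.lcm fun i => kleinNumber d (a i)) ((d - 1) ^ (b - 1)))

theorem dvd_kleinNumber (d a : ℕ) : d ∣ kleinNumber d a := by
  have h := sub_dvd_pow_sub_pow (1 : ℤ) (1 - (d : ℤ)) a
  rw [one_pow, sub_sub_cancel] at h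
  exact Int.natCast_dvd.mp h

theorem kleinNumber_one (d : ℕ) : kleinNumber d 1 = d := by
  simp [kleinNumber]

theorem kleinNumber_ne_zero {d a : ℕ} (hd : 3 ≤ d) (ha : 1 ≤ a) : kleinNumber d a ≠ 0 := by
  intro h
  rw [kleinNumber, Int.natAbs_eq_zero, sub_eq_zero, eq_comm] at h
  have h1 := congrArg Int.natAbs h
  rw [Int.natAbs_pow, Int.natAbs_one, Nat.pow_eq_one] at h1
  omega

/-- The increasing enumeration of a finite set of natural numbers. -/
theorem exists_strictMono_enumeration (S : Finset ℕ) :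
    ∃ a : Fin S.card → ℕ, StrictMono a ∧ (∀ i, a i ∈ S) ∧ (∀ x ∈ S, ∃ i, a i = x) ∧
      ∑ i, a i = ∑ x ∈ S, x := by
  refine ⟨S.orderEmbOfFin rfl, (S.orderEmbOfFin rfl).strictMono,
    fun i => S.orderEmbOfFin_mem rfl i, fun x hx => ?_, ?_⟩
  · rw [← S.image_orderEmbOfFin_univ rfl] at hx
    obtain ⟨i, -, hi⟩ := Finset.mem_image.mp hx
    exact ⟨i, hi⟩
  · conv_rhs => rw [← S.map_orderEmbOfFin_univ rfl, Finset.sum_map]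
    rfl

section CommGroup

variable {G : Type*} [CommGroup G]

theorem iterate_zpow (e : ℤ) (n : ℕ) (x : G) : (fun y : G => y ^ e)^[n] x = x ^ (e ^ n) := by
  induction n with
  | zero => simp
  | succ n ih => rw [iterate_succ_apply', ih, pow_succ, zpow_mul]

theorem pow_kleinNumber_eq_one {d a : ℕ} {p : G}
    (hp : IsPeriodicPt (fun y : G => y ^ (1 - (d : ℤ))) a p) : p ^ kleinNumber d a = 1 := by
  have h : p ^ ((1 - (d : ℤ)) ^ a) = p := by
    rw [← iterate_zpow]; exact hp
  have h1 : p ^ (1 - (1 - (d : ℤ)) ^ a) = 1 := by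
    rw [zpow_sub, h, zpow_one, mul_inv_cancel]
  rw [kleinNumber]
  rcases Int.natAbs_eq (1 - (1 - (d : ℤ)) ^ a) with h2 | h2
  · rwa [h2, zpow_natCast] at h1
  · rwa [h2, zpow_neg, zpow_natCast, inv_eq_one] at h1

theorem pow_sub_one_pow_eq {d k : ℕ} (hd : 1 ≤ d) {x p : G}
    (h : (fun y : G => y ^ (1 - (d : ℤ)))^[k] x = (fun y : G => y ^ (1 - (d : ℤ)))^[k] p) :
    x ^ (d - 1) ^ k = p ^ (d - 1) ^ k := by
  rw [iterate_zpow, iterate_zpow] at h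
  have h1 : (1 - (d : ℤ)) = -((d - 1 : ℕ) : ℤ) := by push_cast [hd]; ring
  rw [h1] at h
  rcases Nat.even_or_odd k with hk | hk
  · rw [hk.neg_pow] at h
    exact_mod_cast h
  · rw [hk.neg_pow, zpow_neg, zpow_neg, inv_inj] at h
    exact_mod_cast h

/-- The weights of a diagonal symmetry of a smooth form coincide after raising to one of the
powers `IsMaximalOrder d N`. Here the counting principle is the only input: the map
`x ↦ x ^ (1 - d)` acts on the set of weights, the lengths of its cycles produce Klein numbers,
and the number `k` of steps needed to enter a cycle produces the factor `(d - 1) ^ k`. -/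
theorem exists_isMaximalOrder_pow_eq [DecidableEq G] {d N : ℕ} (hd : 1 ≤ d) (hN : 1 ≤ N)
    (μ : Fin N → G)
    (h : ∀ (e : ℤ) (c : G), (Finset.univ.filter fun i => μ i ^ e = c).card ≤
      (Finset.univ.filter fun j => μ j ^ e = (c ^ (d - 1))⁻¹).card) :
    ∃ X, IsMaximalOrder d N X ∧ ∀ i j, μ i ^ X = μ j ^ X := by
  set f : G → G := fun y => y ^ (1 - (d : ℤ)) with hf
  have hcount : ∀ j x, hitCount f μ j x ≤ hitCount f μ j (f x) := by
    intro j x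
    have hx : f x = (x ^ (d - 1))⁻¹ := by
      rw [hf, ← zpow_natCast, ← zpow_neg]
      push_cast [hd]
      congr 1
      ring
    have := h ((1 - (d : ℤ)) ^ j) x
    rw [hx]
    simp only [hitCount, hf, iterate_zpow]
    exact this
  obtain ⟨P, k, hper, hst, hfib, hcard, hk⟩ := exists_periodic_card_bound hcount
  rw [Fintype.card_fin] at hcard hk
  set S := P.image (minimalPeriod f) with hS
  have hSle : ∑ a ∈ S, a ≤ P.card := sum_image_minimalPeriod_le hst
  have hSpos : ∀ a ∈ S, 1 ≤ a := by
    intro a ha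
    obtain ⟨p, hp, rfl⟩ := Finset.mem_image.mp ha
    exact minimalPeriod_pos_of_mem_periodicPts (hper p hp)
  have hkill : ∀ X, (∀ a ∈ S, kleinNumber d a ∣ X) → (d - 1) ^ k ∣ X → ∀ i, μ i ^ X = 1 := by
    intro X hX hkX i
    obtain ⟨p, hp, hip⟩ := hfib i
    obtain ⟨Y, rfl⟩ := hkX
    rw [pow_mul, pow_sub_one_pow_eq hd hip, ← pow_mul]
    obtain ⟨Z, hZ⟩ := hX _ (Finset.mem_image_of_mem _ hp)
    rw [hZ, pow_mul, pow_kleinNumber_eq_one (isPeriodicPt_minimalPeriod f p), one_pow]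
  have hconst : ∀ X, (∀ i, μ i ^ X = 1) → ∀ i j, μ i ^ X = μ j ^ X := fun X hX i j => by
    rw [hX i, hX j]
  have hSne : S.Nonempty := by
    obtain ⟨p, hp, -⟩ := hfib ⟨0, hN⟩
    exact ⟨_, Finset.mem_image_of_mem _ hp⟩
  -- an admissible set `T` of cycle lengths and a tail of `k ≥ 1` steps give a number of the last kind
  have htail : ∀ T : Finset ℕ, T.Nonempty → (∀ a ∈ T, 1 ≤ a) → (∑ a ∈ T, a) + (k + 1) ≤ N →
      1 ≤ k → (∀ a ∈ S, ∃ a' ∈ T, kleinNumber d a ∣ kleinNumber d a') →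
      ∃ X, IsMaximalOrder d N X ∧ ∀ i j, μ i ^ X = μ j ^ X := by
    intro T hT hT1 hTN hk1 hdiv
    obtain ⟨a, hmono, hmem, hsurj, hsum⟩ := exists_strictMono_enumeration T
    refine ⟨_, Or.inr (Or.inr (Or.inr (Or.inr ⟨T.card, a, k + 1, Finset.card_pos.mpr hT, hmono,
      fun i => hT1 _ (hmem i), by omega, by omega, rfl⟩))), hconst _ (hkill _ ?_ ?_)⟩
    · intro x hx
      obtain ⟨x', hx', hxx⟩ := hdiv x hx
      obtain ⟨i, rfl⟩ := hsurj x' hx'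
      exact hxx.trans ((Finset.dvd_lcm (f := fun i => kleinNumber d (a i))
        (Finset.mem_univ i)).trans (Nat.dvd_lcm_left _ _))
    · exact Nat.dvd_lcm_right _ _
  by_cases hk0 : k = 0
  · subst hk0
    rcases Nat.lt_or_ge 1 S.card with hS2 | hS1
    · obtain ⟨a, hmono, hmem, hsurj, hsum⟩ := exists_strictMono_enumeration S
      refine ⟨_, Or.inr (Or.inr (Or.inr (Or.inl ⟨S.card, a, hS2, hmono,
        fun i => hSpos _ (hmem i), by omega, rfl⟩))), hconst _ (hkill _ ?_ (by simp))⟩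
      intro x hx
      obtain ⟨i, rfl⟩ := hsurj x hx
      exact Finset.dvd_lcm (f := fun i => kleinNumber d (a i)) (Finset.mem_univ i)
    · obtain ⟨a, ha⟩ := Finset.card_eq_one.mp (le_antisymm hS1 (Finset.card_pos.mpr hSne))
      rw [ha, Finset.sum_singleton] at hSle
      have ha1 : 1 ≤ a := hSpos a (by simp [ha])
      by_cases haN : a ≤ N - 1
      · exact ⟨_, Or.inr (Or.inr (Or.inl ⟨a, ha1, haN, rfl⟩)),
          hconst _ (hkill _ (by simp [ha]) (by simp))⟩
      · obtain rfl : a = N := by omega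
        refine ⟨_, Or.inl rfl, ?_⟩
        -- all weights lie on one cycle of length `N`, so their quotients are powers of `p ^ d`
        obtain ⟨p, hp, hpa⟩ : ∃ p ∈ P, minimalPeriod f p = a :=
          Finset.mem_image.mp (by rw [← hS, ha]; exact Finset.mem_singleton_self a)
        have hall : ∀ i, ∃ n, μ i = f^[n] p := by
          intro i
          obtain ⟨p', hp', hip⟩ := hfib i
          have hO : (Finset.range (minimalPeriod f p)).image (fun n => f^[n] p) = P := by
            refine Finset.eq_of_subset_of_card_le (fun x hx => ?_) ?_
            · obtain ⟨n, -, rfl⟩ := Finset.mem_image.mp hx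
              exact hst p hp n
            · rw [card_image_iterate_range_minimalPeriod, hpa]
              exact hcard
          rw [← hO] at hp'
          obtain ⟨n, -, hn⟩ := Finset.mem_image.mp hp'
          exact ⟨n, by rw [hn]; exact hip⟩
        have hpow : ∀ i, μ i ^ (kleinNumber d a / d) = p ^ (kleinNumber d a / d) := by
          intro i
          obtain ⟨n, hn⟩ := hall i
          have hp1 : p ^ kleinNumber d a = 1 :=
            pow_kleinNumber_eq_one (hpa ▸ isPeriodicPt_minimalPeriod f p)
          have hdvd := sub_dvd_pow_sub_pow (1 - (d : ℤ)) 1 n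
          rw [one_pow, show (1 - (d : ℤ)) - 1 = -d by ring, neg_dvd] at hdvd
          obtain ⟨z, hz⟩ := hdvd
          rw [hn, hf, iterate_zpow, show (1 - (d : ℤ)) ^ n = d * z + 1 by linarith, zpow_add,
            zpow_one, mul_pow, zpow_mul, zpow_natCast, ← zpow_natCast, ← zpow_mul, mul_comm z,
            zpow_mul, zpow_natCast, ← pow_mul, Nat.mul_div_cancel' (dvd_kleinNumber d a), hp1,
            one_zpow, one_mul]
        intro i j
        rw [hpow i, hpow j]
  · obtain ⟨p, hp, hpN⟩ := hk hk0
    have hk1 : 1 ≤ k := Nat.one_le_iff_ne_zero.mpr hk0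
    set a := minimalPeriod f p with ha
    have haS : a ∈ S := Finset.mem_image_of_mem _ hp
    rcases Nat.lt_or_ge 1 a with ha2 | ha1
    · refine htail S hSne hSpos ?_ hk1 fun x hx => ⟨x, hx, dvd_rfl⟩
      have : k + 1 ≤ k * a := by nlinarith
      omega
    · have ha1' : a = 1 := le_antisymm ha1 (hSpos a haS)
      rw [ha1', mul_one] at hpN
      rw [ha1'] at haS
      -- a cycle of length one only contributes `d`, which divides every Klein number
      by_cases hS' : (S.erase 1).Nonempty
      · refine htail (S.erase 1) hS' (fun x hx => hSpos x (Finset.mem_of_mem_erase hx)) ?_ hk1 ?_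
        · have := Finset.add_sum_erase S (fun x => x) haS
          omega
        · intro x hx
          by_cases hx1 : x = 1
          · obtain ⟨y, hy⟩ := hS'
            exact ⟨y, hy, by rw [hx1, kleinNumber_one]; exact dvd_kleinNumber d y⟩
          · exact ⟨x, Finset.mem_erase.mpr ⟨hx1, hx⟩, dvd_rfl⟩
      · have hS1 : ∀ x ∈ S, x = 1 := by
          intro x hx
          by_contra hx1
          exact hS' ⟨x, Finset.mem_erase.mpr ⟨hx1, hx⟩⟩
        rcases Nat.lt_or_ge 1 P.card with hP2 | hP1
        · refine htail {1} (by simp) (by simp) ?_ hk1 fun x hx => ⟨1, by simp, by rw [hS1 x hx]⟩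
          rw [Finset.sum_singleton]
          omega
        · refine ⟨_, Or.inr (Or.inl rfl), ?_⟩
          have hPp : ∀ p' ∈ P, p' = p := fun p' hp' =>
            Finset.card_le_one.mp hP1 p' hp' p hp
          have hpow : ∀ i, μ i ^ (d - 1) ^ (N - 1) = p ^ (d - 1) ^ (N - 1) := by
            intro i
            obtain ⟨p', hp', hip⟩ := hfib i
            rw [hPp p' hp'] at hip
            have hPpos : 1 ≤ P.card := Finset.card_pos.mpr ⟨p, hp⟩
            rw [show N - 1 = k + (N - 1 - k) by omega, pow_add, pow_mul, pow_mul,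
              pow_sub_one_pow_eq hd hip]
          intro i j
          rw [hpow i, hpow j]

end CommGroup

/-! ### Projective linear transformations -/

section Projective

variable {N : ℕ}

open Matrix.ProjGenLinGroup

theorem mk_smul_mem_V_iff (F : MvPolynomial (Fin N) ℂ) (A : GL (Fin N) ℂ) {v : Fin N → ℂ}
    (hv : v ≠ 0) : mk A • Projectivization.mk ℂ v hv ∈ V F ↔
      ∀ t : ℂ, eval (t • (A : Matrix (Fin N) (Fin N) ℂ).mulVec v) F = 0 := by
  rw [Projectivization.PGL.mk_smul_mk]
  simp only [V, Set.mem_ofPred_eq, Projectivization.submodule_mk, Submodule.mem_span_singleton,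
    forall_exists_index, forall_apply_eq_imp_iff]
  rfl

theorem mem_V_iff (F : MvPolynomial (Fin N) ℂ) {v : Fin N → ℂ}
    (hv : v ≠ 0) : Projectivization.mk ℂ v hv ∈ V F ↔ ∀ t : ℂ, eval (t • v) F = 0 := by
  simp only [V, Set.mem_ofPred_eq, Projectivization.submodule_mk, Submodule.mem_span_singleton,
    forall_exists_index, forall_apply_eq_imp_iff]

theorem mk_mem_Lin_iff (F : MvPolynomial (Fin N) ℂ) (A : GL (Fin N) ℂ) :
    mk A ∈ Lin F ↔ ∀ v : Fin N → ℂ, v ≠ 0 → ((∀ t : ℂ, eval (t • v) F = 0) ↔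
      ∀ t : ℂ, eval (t • (A : Matrix (Fin N) (Fin N) ℂ).mulVec v) F = 0) := by
  rw [Lin, MulAction.mem_stabilizer_iff]
  constructor
  · intro h v hv
    rw [← mem_V_iff F hv, ← mk_smul_mem_V_iff F A hv]
    conv_rhs => rw [← h]
    exact (Set.smul_mem_smul_set_iff).symm
  · intro h
    have key : ∀ p : ℙ ℂ (Fin N → ℂ), p ∈ V F ↔ mk A • p ∈ V F := by
      intro p
      induction p using Projectivization.ind with | _ v hv =>
      rw [mem_V_iff F hv, mk_smul_mem_V_iff F A hv]
      exact h v hv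
    ext p
    rw [Set.mem_smul_set_iff_inv_smul_mem, key, smul_inv_smul]

theorem mk_mem_Lin_of_forall_eval_eq {F : MvPolynomial (Fin N) ℂ} {A : GL (Fin N) ℂ}
    (h : ∀ v, eval ((A : Matrix (Fin N) (Fin N) ℂ).mulVec v) F = eval v F) : mk A ∈ Lin F := by
  rw [mk_mem_Lin_iff]
  intro v _
  simp only [← Matrix.mulVec_smul, h]

theorem eval_mulVec_eq_zero_of_mk_mem_Lin {F : MvPolynomial (Fin N) ℂ} {d : ℕ}
    (hF : F.IsHomogeneous d) {A : GL (Fin N) ℂ} (h : mk A ∈ Lin F) {v : Fin N → ℂ}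
    (hv : eval v F = 0) : eval ((A : Matrix (Fin N) (Fin N) ℂ).mulVec v) F = 0 := by
  by_cases hv0 : v = 0
  · rwa [hv0, Matrix.mulVec_zero, ← hv0]
  · have h1 := ((mk_mem_Lin_iff F A).mp h v hv0).mp fun t => by
      rw [eval_smul_of_isHomogeneous hF, hv, mul_zero]
    simpa using h1 1

/-- A linear automorphism of a smooth hypersurface of degree `d ≥ 1` lifts to a linear map that
fixes the equation: any lift multiplies it by a constant, which a `d`-th root removes. -/
theorem IsSmoothForm.exists_lift {F : MvPolynomial (Fin N) ℂ} {d : ℕ} (hd : 1 ≤ d) (hN : 2 ≤ N)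
    (hF : IsSmoothForm d F) {g : Matrix.ProjGenLinGroup (Fin N) ℂ} (hg : g ∈ Lin F) :
    ∃ A : GL (Fin N) ℂ, mk A = g ∧
      ∀ v, eval ((A : Matrix (Fin N) (Fin N) ℂ).mulVec v) F = eval v F := by
  obtain ⟨A, rfl⟩ := mk_surjective g
  have hsq := hF.squarefree hN
  have hG0 : substMatrix (A : Matrix (Fin N) (Fin N) ℂ) F ≠ 0 := by
    intro h0
    refine hsq.ne_zero (MvPolynomial.funext fun v => ?_)
    have h1 := eval_substMatrix A.val F ((A⁻¹ : GL (Fin N) ℂ).val.mulVec v)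
    rwa [h0, Matrix.mulVec_mulVec, ← Units.val_mul, mul_inv_cancel, Units.val_one,
      Matrix.one_mulVec, map_zero, eq_comm] at h1
  obtain ⟨c, hc, hcF⟩ := exists_eq_const_mul hF.1 (isHomogeneous_substMatrix hF.1 _) hsq hG0
    fun v hv => by
      rw [eval_substMatrix]
      exact eval_mulVec_eq_zero_of_mk_mem_Lin hF.1 hg hv
  obtain ⟨z, hz⟩ := IsAlgClosed.exists_pow_nat_eq c⁻¹ hd
  have hz0 : z ≠ 0 := by
    rintro rfl
    rw [zero_pow (by omega), eq_comm, inv_eq_zero] at hz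
    exact hc hz
  refine ⟨A * Matrix.GeneralLinearGroup.scalar (Fin N) (Units.mk0 z hz0), ?_, fun v => ?_⟩
  · rw [map_mul, mk_scalar, mul_one]
  · have h1 : ((A * Matrix.GeneralLinearGroup.scalar (Fin N) (Units.mk0 z hz0) :
        GL (Fin N) ℂ) : Matrix (Fin N) (Fin N) ℂ).mulVec v =
        z • (A : Matrix (Fin N) (Fin N) ℂ).mulVec v := by
      rw [Units.val_mul, Matrix.GeneralLinearGroup.coe_scalar, ← Matrix.mulVec_mulVec,
        ← Matrix.mulVec_smul]
      congr 1
      funext i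
      simp
    rw [h1, eval_smul_of_isHomogeneous hF.1, hz, ← eval_substMatrix, hcF, map_mul, eval_C,
      inv_mul_cancel_left₀ hc]

theorem mk_pow_eq_one_of_eigenvectors {A : GL (Fin N) ℂ}
    (b : Module.Basis (Fin N) ℂ (Fin N → ℂ)) {μ : Fin N → ℂˣ}
    (hb : ∀ i, (A : Matrix (Fin N) (Fin N) ℂ).mulVec (b i) = (μ i : ℂ) • b i) {X : ℕ}
    (hX : ∀ i j, μ i ^ X = μ j ^ X) : mk A ^ X = 1 := by
  rcases isEmpty_or_nonempty (Fin N) with hN | ⟨⟨i₀⟩⟩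
  · rw [← map_pow, Subsingleton.elim (A ^ X) 1, map_one]
  have hpow : ∀ (n : ℕ) (i : Fin N),
      ((A : Matrix (Fin N) (Fin N) ℂ) ^ n).mulVec (b i) = ((μ i : ℂ) ^ n) • b i := by
    intro n i
    induction n with
    | zero => simp
    | succ n ih => rw [pow_succ', ← Matrix.mulVec_mulVec, ih, Matrix.mulVec_smul, hb, smul_smul,
        pow_succ]
  have hmat : (A : Matrix (Fin N) (Fin N) ℂ) ^ X = Matrix.scalar (Fin N) ((μ i₀ : ℂ) ^ X) := by
    apply Matrix.toLin'.injective
    refine b.ext fun i => ?_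
    rw [Matrix.toLin'_apply, hpow, Matrix.toLin'_apply]
    have : ((μ i : ℂ) ^ X) = (μ i₀ : ℂ) ^ X := by exact_mod_cast congrArg Units.val (hX i i₀)
    rw [this]
    funext j
    simp
  have : A ^ X = Matrix.GeneralLinearGroup.scalar (Fin N) (μ i₀ ^ X) := by
    apply Units.ext
    rw [Units.val_pow_eq_pow_val, hmat, Matrix.GeneralLinearGroup.coe_scalar]
    simp
  rw [← map_pow, this, mk_scalar]

/-- The order of a linear automorphism of a smooth hypersurface divides one of the numbers
described by `IsMaximalOrder`. -/
theorem IsSmoothForm.exists_orderOf_dvd {F : MvPolynomial (Fin N) ℂ} {d : ℕ} (hd : 3 ≤ d)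
    (hN : 2 ≤ N) (hF : IsSmoothForm d F) {g : Matrix.ProjGenLinGroup (Fin N) ℂ}
    (hg : g ∈ Lin F) : ∃ X, IsMaximalOrder d N X ∧ orderOf g ∣ X := by
  obtain ⟨A, rfl, hA⟩ := hF.exists_lift (by omega) hN hg
  set M : Matrix (Fin N) (Fin N) ℂ := A.val with hM
  set M' : Matrix (Fin N) (Fin N) ℂ := (A⁻¹ : GL (Fin N) ℂ).val with hM'
  have hMM' : M * M' = 1 := by rw [hM, hM', ← Units.val_mul, mul_inv_cancel, Units.val_one]
  have hM'M : M' * M = 1 := mul_eq_one_comm.mp hMM'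
  obtain ⟨K, hK⟩ := hF.exists_entry_bound hd
  have hpow : ∀ (m : ℕ) v, eval ((M ^ m).mulVec v) F = eval v F := by
    intro m
    induction m with
    | zero => simp
    | succ m ih => intro v; rw [pow_succ, ← Matrix.mulVec_mulVec, ih, hA]
  have hbd := fun m => hK (M ^ m) (M' ^ m) (pow_mul_pow_eq_one m hMM') (hpow m)
  obtain ⟨b, μ, hb⟩ := exists_basis_eigenvectors hM'M (fun m => (hbd m).1) fun m => (hbd m).2
  have hμ0 : ∀ i, μ i ≠ 0 := by
    intro i h0
    have h1 := hb i
    rw [h0, zero_smul] at h1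
    refine b.ne_zero i ?_
    rw [← Matrix.one_mulVec (b i), ← hM'M, ← Matrix.mulVec_mulVec, h1, Matrix.mulVec_zero]
  let ν : Fin N → ℂˣ := fun i => Units.mk0 (μ i) (hμ0 i)
  -- in the coordinates of the basis `b` the symmetry becomes diagonal
  let Q : Matrix (Fin N) (Fin N) ℂ := LinearMap.toMatrix' b.equivFun.symm.toLinearMap
  let Q' : Matrix (Fin N) (Fin N) ℂ := LinearMap.toMatrix' b.equivFun.toLinearMap
  have hQQ' : Q * Q' = 1 := by
    rw [← LinearMap.toMatrix'_comp]
    simp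
  have hQv : ∀ v, Q.mulVec v = ∑ i, v i • b i := by
    intro v
    rw [← Matrix.toLin'_apply, Matrix.toLin'_toMatrix']
    simp [Module.Basis.equivFun_symm_apply]
  have hinv : ∀ v : Fin N → ℂ, eval (fun i => (ν i : ℂ) * v i) (substMatrix Q F) =
      eval v (substMatrix Q F) := by
    intro v
    rw [eval_substMatrix, eval_substMatrix, ← hA (Q.mulVec v), hQv, hQv, Matrix.mulVec_sum]
    refine congrArg (fun w => eval w F) (Finset.sum_congr rfl fun i _ => ?_)
    rw [Matrix.mulVec_smul, hb, smul_smul, mul_comm]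
    rfl
  obtain ⟨X, hX, hXν⟩ := exists_isMaximalOrder_pow_eq (d := d) (N := N) (by omega) (by omega) ν
    fun e c => (isSmoothForm_substMatrix hF hQQ').card_weight_le (by omega) hinv (zpowGroupHom e) c
  exact ⟨X, hX, orderOf_dvd_of_pow_eq_one (mk_pow_eq_one_of_eigenvectors b hb hXν)⟩

end Projective

/-! ### Diagonal automorphisms -/

section Diagonal

variable {N : ℕ}

open Matrix.ProjGenLinGroup

/-- The class in `PGL(N, ℂ)` of the diagonal matrix with entries `c`. -/
noncomputable def diagPGL : (Fin N → ℂˣ) →* Matrix.ProjGenLinGroup (Fin N) ℂ :=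
  mk.comp ((Units.map (Matrix.diagonalRingHom (Fin N) ℂ).toMonoidHom).comp
    (MulEquiv.piUnits (M := fun _ : Fin N => ℂ)).symm.toMonoidHom)

theorem diagPGL_eq_one_iff (c : Fin N → ℂˣ) : diagPGL c = 1 ↔ ∀ i j, c i = c j := by
  have h1 : diagPGL c = 1 ↔ ∃ u : ℂˣ, ∀ i, c i = u := by
    rw [diagPGL, MonoidHom.comp_apply, mk_eq_one, Matrix.GeneralLinearGroup.center_eq_range_scalar,
      MonoidHom.mem_range]
    refine exists_congr fun u => ?_
    rw [Units.ext_iff, Matrix.GeneralLinearGroup.coe_scalar]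
    constructor
    · intro h i
      have := congrFun (congrFun h i) i
      simp only [Matrix.scalar_apply, Matrix.diagonal_apply_eq] at this
      refine Units.ext (this.trans ?_).symm
      exact Matrix.diagonal_apply_eq _ i
    · intro h
      rw [Matrix.scalar_apply]
      refine congrArg Matrix.diagonal (funext fun i => ?_)
      exact congrArg Units.val (h i).symm
  rw [h1]
  constructor
  · rintro ⟨u, hu⟩ i j
    rw [hu, hu]
  · intro h
    rcases isEmpty_or_nonempty (Fin N) with hN | ⟨⟨i₀⟩⟩
    · exact ⟨1, fun i => hN.elim i⟩
    · exact ⟨c i₀, fun i => h i i₀⟩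

/-- The diagonal substitutions that fix the polynomial `F`. -/
def diagonalSymmetries (F : MvPolynomial (Fin N) ℂ) : Submonoid (Fin N → ℂˣ) where
  carrier := {c | ∀ v : Fin N → ℂ, eval (fun i => (c i : ℂ) * v i) F = eval v F}
  one_mem' v := by simp
  mul_mem' {c c'} hc hc' v := by
    rw [← hc' v, ← hc fun i => (c' i : ℂ) * v i]
    simp [mul_assoc]

theorem diagPGL_mem_Lin {F : MvPolynomial (Fin N) ℂ} {c : Fin N → ℂˣ}
    (hc : c ∈ diagonalSymmetries F) : diagPGL c ∈ Lin F := by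
  refine mk_mem_Lin_of_forall_eval_eq fun v => ?_
  rw [← hc v]
  congr 2
  funext i
  exact Matrix.mulVec_diagonal _ v i

/-- `X` is the order in `PGL(N, ℂ)` of a diagonal substitution that fixes `F`. -/
def IsDiagonalOrder (F : MvPolynomial (Fin N) ℂ) (X : ℕ) : Prop :=
  X ≠ 0 ∧ ∃ h ∈ (diagonalSymmetries F).map diagPGL, orderOf h = X

variable {F : MvPolynomial (Fin N) ℂ}

theorem IsDiagonalOrder.exists_mem_Lin {X n : ℕ} (hX : IsDiagonalOrder F X) (hn : n ∣ X) :
    ∃ h ∈ Lin F, orderOf h = n := by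
  obtain ⟨hX0, h, ⟨c, hc, rfl⟩, hord⟩ := hX
  have hn0 : n ≠ 0 := ne_zero_of_dvd_ne_zero hX0 hn
  refine ⟨diagPGL c ^ (X / n), pow_mem (diagPGL_mem_Lin hc) _, ?_⟩
  rw [orderOf_pow_of_dvd (Nat.div_pos (Nat.le_of_dvd (Nat.pos_of_ne_zero hX0) hn)
    (Nat.pos_of_ne_zero hn0)).ne' (hord.symm ▸ Nat.div_dvd_of_dvd hn), hord, Nat.div_div_self hn hX0]

theorem IsDiagonalOrder.one : IsDiagonalOrder F 1 :=
  ⟨one_ne_zero, 1, one_mem _, orderOf_one⟩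

theorem IsDiagonalOrder.lcm {X Y : ℕ} (hX : IsDiagonalOrder F X) (hY : IsDiagonalOrder F Y) :
    IsDiagonalOrder F (Nat.lcm X Y) := by
  obtain ⟨hX0, x, hx, rfl⟩ := hX
  obtain ⟨hY0, y, hy, rfl⟩ := hY
  have hcomm : Commute x y := by
    obtain ⟨c, -, rfl⟩ := hx
    obtain ⟨c', -, rfl⟩ := hy
    exact (Commute.all c c').map diagPGL
  obtain ⟨z, hz, hord⟩ := hcomm.exists_orderOf_eq_lcm
  refine ⟨Nat.lcm_ne_zero hX0 hY0, z, ?_, hord⟩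
  refine (Submonoid.closure_le.mpr ?_) hz
  rintro w (rfl | rfl)
  · exact hx
  · exact hy

theorem IsDiagonalOrder.finset_lcm {ι : Type*} (s : Finset ι) (X : ι → ℕ)
    (h : ∀ i ∈ s, IsDiagonalOrder F (X i)) : IsDiagonalOrder F (s.lcm X) := by
  classical
  induction s using Finset.induction_on with
  | empty => exact IsDiagonalOrder.one
  | insert i s _ ih =>
    rw [Finset.lcm_insert]
    exact (h i (by simp)).lcm (ih fun j hj => h j (Finset.mem_insert_of_mem hj))

theorem isDiagonalOrder_of_forall_iff {X : ℕ} (hX : X ≠ 0) {c : Fin N → ℂˣ}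
    (hc : c ∈ diagonalSymmetries F) (h : ∀ m : ℕ, (∀ i j, c i ^ m = c j ^ m) ↔ X ∣ m) :
    IsDiagonalOrder F X := by
  refine ⟨hX, _, ⟨c, hc, rfl⟩, ?_⟩
  have hiff : ∀ m : ℕ, diagPGL c ^ m = 1 ↔ X ∣ m := by
    intro m
    rw [← map_pow, diagPGL_eq_one_iff, ← h]
    rfl
  exact Nat.dvd_antisymm (orderOf_dvd_of_pow_eq_one ((hiff X).mpr dvd_rfl))
    ((hiff _).mp (pow_orderOf_eq_one _))

end Diagonal

/-! ### Orders attained on simple polynomials -/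

theorem exists_units_orderOf_eq {X : ℕ} (hX : X ≠ 0) : ∃ ζ : ℂˣ, orderOf ζ = X := by
  have h := Complex.isPrimitiveRoot_exp X hX
  refine ⟨(h.isUnit hX).unit, ?_⟩
  rw [← orderOf_units, IsUnit.unit_spec, ← h.eq_orderOf]

theorem zpow_pow_mul_zpow_succ {G : Type*} [CommGroup G] {d : ℕ} (hd : 1 ≤ d) (ζ : G) (k : ℕ) :
    (ζ ^ ((1 - (d : ℤ)) ^ k)) ^ (d - 1) * ζ ^ ((1 - (d : ℤ)) ^ (k + 1)) = 1 := by
  rw [← zpow_natCast, ← zpow_mul, ← zpow_add]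
  push_cast [hd]
  rw [pow_succ, ← mul_add, show (d : ℤ) - 1 + (1 - d) = 0 by ring, mul_zero, zpow_zero]

theorem zpow_pow_eq_self_of_orderOf_eq_kleinNumber {G : Type*} [CommGroup G] {d a : ℕ} {ζ : G}
    (hζ : orderOf ζ = kleinNumber d a) : ζ ^ ((1 - (d : ℤ)) ^ a) = ζ := by
  have h : ζ ^ (1 - (1 - (d : ℤ)) ^ a) = 1 := by
    rw [← orderOf_dvd_iff_zpow_eq_one, hζ, kleinNumber, Int.natCast_natAbs]
    exact (abs_dvd _ _).mpr dvd_rfl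
  rw [zpow_sub, zpow_one, mul_inv_eq_one] at h
  exact h.symm

theorem finRotate_val {k : ℕ} (i : Fin k) :
    (finRotate k i).1 = if i.1 + 1 < k then i.1 + 1 else 0 := by
  obtain ⟨i, hi⟩ := i
  rcases k with _ | k
  · omega
  · split_ifs with h
    · rw [finRotate_of_lt (by simpa using h)]
    · obtain rfl : i = k := by simp at h; omega
      rw [finRotate_last']

section Simple

variable {N t s d : ℕ} {a : Fin t → ℕ} {b : Fin s → ℕ}

/-- The simple polynomial whose variables are distributed among the components by `e`. -/
noncomputable def simplePolynomial (d : ℕ)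
    (e : ((i : Fin t) × Fin (a i)) ⊕ ((j : Fin s) × Fin (b j)) ≃ Fin N) :
    MvPolynomial (Fin N) ℂ :=
  ∑ i, rename (fun k => e (Sum.inl ⟨i, k⟩)) (typeK d (a i)) +
    ∑ j, rename (fun k => e (Sum.inr ⟨j, k⟩)) (typeT d (b j))

variable {e : ((i : Fin t) × Fin (a i)) ⊕ ((j : Fin s) × Fin (b j)) ≃ Fin N}

/-- A diagonal substitution fixes a simple polynomial if each of its monomials has weight one. -/
theorem mem_diagonalSymmetries_simplePolynomial
    {c : ((i : Fin t) × Fin (a i)) ⊕ ((j : Fin s) × Fin (b j)) → ℂˣ}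
    (hK : ∀ i k, c (Sum.inl ⟨i, k⟩) ^ (d - 1) * c (Sum.inl ⟨i, finRotate (a i) k⟩) = 1)
    (hT : ∀ j (k : Fin (b j)) (h : k.1 + 1 < b j),
      c (Sum.inr ⟨j, k⟩) ^ (d - 1) * c (Sum.inr ⟨j, ⟨k.1 + 1, h⟩⟩) = 1)
    (hT' : ∀ j (k : Fin (b j)), ¬ k.1 + 1 < b j → c (Sum.inr ⟨j, k⟩) ^ d = 1) :
    c ∘ e.symm ∈ diagonalSymmetries (simplePolynomial d e) := by
  intro v
  simp only [simplePolynomial, map_add, map_sum, eval_rename]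
  congr 1
  · refine Finset.sum_congr rfl fun i _ => ?_
    simp only [typeK, map_sum, map_mul, map_pow, eval_X, comp_apply, Equiv.symm_apply_apply]
    refine Finset.sum_congr rfl fun k _ => ?_
    have h := congrArg Units.val (hK i k)
    push_cast at h
    rw [mul_pow, mul_mul_mul_comm, h, one_mul]
  · refine Finset.sum_congr rfl fun j _ => ?_
    simp only [typeT, map_sum]
    refine Finset.sum_congr rfl fun k _ => ?_
    split_ifs with hk
    · simp only [map_mul, map_pow, eval_X, comp_apply, Equiv.symm_apply_apply]
      have h := congrArg Units.val (hT j k hk)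
      push_cast at h
      rw [mul_pow, mul_mul_mul_comm, h, one_mul]
    · simp only [map_pow, eval_X, comp_apply, Equiv.symm_apply_apply]
      have h := congrArg Units.val (hT' j k hk)
      push_cast at h
      rw [mul_pow, h, one_mul]

/-- The substitution acting on the component `K_{a i₀}` by the weights `ζ ^ (1 - d) ^ k` and
trivially on the other components. -/
noncomputable def weightsK (d : ℕ) (i₀ : Fin t) (ζ : ℂˣ) :
    ((i : Fin t) × Fin (a i)) ⊕ ((j : Fin s) × Fin (b j)) → ℂˣ :=
  Sum.elim (fun x => if x.1 = i₀ then ζ ^ ((1 - (d : ℤ)) ^ x.2.1) else 1) fun _ => 1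

theorem weightsK_mem (hd : 1 ≤ d) {i₀ : Fin t} {ζ : ℂˣ}
    (hζ : orderOf ζ = kleinNumber d (a i₀)) :
    weightsK d i₀ ζ ∘ e.symm ∈ diagonalSymmetries (simplePolynomial d e) := by
  refine mem_diagonalSymmetries_simplePolynomial (fun i k => ?_) (fun j k h => ?_)
    fun j k h => ?_
  · simp only [weightsK, Sum.elim_inl]
    by_cases hi : i = i₀
    · subst hi
      simp only [if_true]
      rw [finRotate_val]
      split_ifs with hk
      · exact zpow_pow_mul_zpow_succ hd ζ k.1
      · have h1 := zpow_pow_mul_zpow_succ hd ζ k.1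
        rw [show k.1 + 1 = a i by omega, zpow_pow_eq_self_of_orderOf_eq_kleinNumber hζ] at h1
        rw [pow_zero, zpow_one, h1]
    · simp [hi]
  · simp [weightsK]
  · simp [weightsK]

/-- Klein numbers of the components of type `K` are attained, if there is a further component,
on which the substitution is trivial. -/
theorem isDiagonalOrder_kleinNumber (hd : 3 ≤ d) (i₀ : Fin t) (hi₀ : 1 ≤ a i₀)
    (y : ((i : Fin t) × Fin (a i)) ⊕ ((j : Fin s) × Fin (b j)))
    (hy : ∀ k, y ≠ Sum.inl ⟨i₀, k⟩) :
    IsDiagonalOrder (simplePolynomial d e) (kleinNumber d (a i₀)) := by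
  have h0 := kleinNumber_ne_zero hd hi₀
  obtain ⟨ζ, hζ⟩ := exists_units_orderOf_eq h0
  refine isDiagonalOrder_of_forall_iff h0 (weightsK_mem (by omega) hζ) fun m => ?_
  constructor
  · intro h
    have h1 := h (e (Sum.inl ⟨i₀, ⟨0, hi₀⟩⟩)) (e y)
    have hy1 : weightsK d i₀ ζ y = 1 := by
      rcases y with ⟨i, k⟩ | y
      · have : i ≠ i₀ := by
          rintro rfl
          exact hy k rfl
        simp [weightsK, this]
      · rfl
    simp only [comp_apply, Equiv.symm_apply_apply, hy1, one_pow] at h1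
    rw [← hζ]
    exact orderOf_dvd_of_pow_eq_one (by simpa [weightsK] using h1)
  · intro hm
    have hζm : ζ ^ m = 1 := orderOf_dvd_iff_pow_eq_one.mp (hζ ▸ hm)
    have h1 : ∀ x, weightsK (a := a) (b := b) d i₀ ζ x ^ m = 1 := by
      rintro (x | x)
      · simp only [weightsK, Sum.elim_inl]
        split_ifs
        · rw [← zpow_natCast, ← zpow_mul, mul_comm, zpow_mul, zpow_natCast, hζm, one_zpow]
        · exact one_pow m
      · exact one_pow m
    intro i j
    simp only [comp_apply, h1]

/-- On a single component of type `K` the order drops by the factor `d`, because the quotient of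
the first two weights is `ζ ^ d`. -/
theorem isDiagonalOrder_kleinNumber_div (hd : 3 ≤ d) (i₀ : Fin t) (hi₀ : 2 ≤ a i₀)
    (hall : ∀ y : ((i : Fin t) × Fin (a i)) ⊕ ((j : Fin s) × Fin (b j)),
      ∃ k, y = Sum.inl ⟨i₀, k⟩) :
    IsDiagonalOrder (simplePolynomial d e) (kleinNumber d (a i₀) / d) := by
  have h0 := kleinNumber_ne_zero hd (show 1 ≤ a i₀ by omega)
  have hdvd := dvd_kleinNumber d (a i₀)
  obtain ⟨ζ, hζ⟩ := exists_units_orderOf_eq h0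
  have hX : kleinNumber d (a i₀) / d ≠ 0 :=
    (Nat.div_pos (Nat.le_of_dvd (Nat.pos_of_ne_zero h0) hdvd) (by omega)).ne'
  have hiff : ∀ m : ℕ, ζ ^ (d * m) = 1 ↔ kleinNumber d (a i₀) / d ∣ m := by
    intro m
    rw [← orderOf_dvd_iff_pow_eq_one, hζ, Nat.div_dvd_iff_dvd_mul hdvd (by omega)]
  refine isDiagonalOrder_of_forall_iff hX (weightsK_mem (by omega) hζ) fun m => ?_
  rw [← hiff]
  constructor
  · intro h
    have h1 := h (e (Sum.inl ⟨i₀, ⟨0, by omega⟩⟩)) (e (Sum.inl ⟨i₀, ⟨1, by omega⟩⟩))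
    simp only [weightsK, comp_apply, Equiv.symm_apply_apply, Sum.elim_inl, if_true, pow_zero,
      zpow_one, pow_one] at h1
    rw [← zpow_natCast (ζ ^ _), ← zpow_mul, sub_mul, one_mul, zpow_sub, zpow_natCast, eq_comm,
      mul_inv_eq_iff_eq_mul, left_eq_mul] at h1
    exact_mod_cast h1
  · intro hm
    have h1 : ∀ x, weightsK (a := a) (b := b) d i₀ ζ x ^ m = ζ ^ m := by
      intro x
      obtain ⟨k, rfl⟩ := hall x
      simp only [weightsK, Sum.elim_inl, if_true]
      obtain ⟨z, hz⟩ := sub_dvd_pow_sub_pow (1 - (d : ℤ)) 1 k.1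
      rw [one_pow, show (1 - (d : ℤ)) - 1 = -d by ring] at hz
      rw [show (1 - (d : ℤ)) ^ k.1 = d * (-z) + 1 by linarith, zpow_add, zpow_one, mul_pow,
        zpow_mul, zpow_natCast, ← zpow_natCast, ← zpow_mul, mul_comm (-z), zpow_mul,
        zpow_natCast, ← pow_mul, hm, one_zpow, one_mul]
    intro i j
    simp only [comp_apply, h1]

/-- On a component of type `T_b` there is a symmetry of order `(d - 1) ^ (b - 1)`, which fixes the
last variable. -/
theorem isDiagonalOrder_pow (hd : 2 ≤ d) (j₀ : Fin s) (hj₀ : 1 ≤ b j₀) :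
    IsDiagonalOrder (simplePolynomial d e) ((d - 1) ^ (b j₀ - 1)) := by
  have h0 : (d - 1) ^ (b j₀ - 1) ≠ 0 := pow_ne_zero _ (by omega)
  obtain ⟨ζ, hζ⟩ := exists_units_orderOf_eq h0
  have hlast : ζ ^ ((1 - (d : ℤ)) ^ (b j₀ - 1)) = 1 := by
    rw [← orderOf_dvd_iff_zpow_eq_one, hζ]
    push_cast [show 1 ≤ d by omega]
    exact pow_dvd_pow_of_dvd ⟨-1, by ring⟩ _
  let c : ((i : Fin t) × Fin (a i)) ⊕ ((j : Fin s) × Fin (b j)) → ℂˣ :=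
    Sum.elim (fun _ => 1) fun x => if x.1 = j₀ then ζ ^ ((1 - (d : ℤ)) ^ x.2.1) else 1
  have hc : c ∘ e.symm ∈ diagonalSymmetries (simplePolynomial d e) := by
    refine mem_diagonalSymmetries_simplePolynomial (fun i k => ?_) (fun j k h => ?_)
      fun j k h => ?_
    · simp [c]
    · simp only [c, Sum.elim_inr]
      split_ifs
      · exact zpow_pow_mul_zpow_succ (by omega) ζ k.1
      · simp
    · simp only [c, Sum.elim_inr]
      split_ifs with hj
      · subst hj
        rw [show k.1 = b j - 1 by omega, hlast, one_pow]
      · simp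
  refine isDiagonalOrder_of_forall_iff h0 hc fun m => ?_
  constructor
  · intro h
    have h1 := h (e (Sum.inr ⟨j₀, ⟨0, hj₀⟩⟩)) (e (Sum.inr ⟨j₀, ⟨b j₀ - 1, by omega⟩⟩))
    simp only [c, comp_apply, Equiv.symm_apply_apply, Sum.elim_inr, if_true, pow_zero, zpow_one,
      hlast, one_pow] at h1
    rw [← hζ]
    exact orderOf_dvd_of_pow_eq_one h1
  · intro hm
    have hζm : ζ ^ m = 1 := orderOf_dvd_iff_pow_eq_one.mp (hζ ▸ hm)
    have h1 : ∀ x, c x ^ m = 1 := by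
      rintro (x | x)
      · exact one_pow m
      · simp only [c, Sum.elim_inr]
        split_ifs
        · rw [← zpow_natCast, ← zpow_mul, mul_comm, zpow_mul, zpow_natCast, hζm, one_zpow]
        · exact one_pow m
    intro i j
    simp only [comp_apply, h1]

theorem exists_variable_distribution (h : ∑ i, a i + ∑ j, b j = N) :
    Nonempty (((i : Fin t) × Fin (a i)) ⊕ ((j : Fin s) × Fin (b j)) ≃ Fin N) :=
  ⟨Fintype.equivFinOfCardEq (by simp [h])⟩

theorem isSimpleWithAtMostOneT_simplePolynomial (ha : ∀ i, 1 ≤ a i) (hb : ∀ j, 1 ≤ b j)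
    (hb2 : ∀ j j' : Fin s, 2 ≤ b j → 2 ≤ b j' → j = j') :
    IsSimpleWithAtMostOneT d (simplePolynomial d e) :=
  ⟨t, s, a, b, ⟨ha, hb, e, rfl⟩, hb2⟩

/-- With at least two components, the least common multiple of all Klein numbers of
components of type `K` and of all `(d - 1) ^ (b - 1)` for components of type `T_b` is attained. -/
theorem isDiagonalOrder_lcm (hd : 3 ≤ d) (ha : ∀ i, 1 ≤ a i) (hb : ∀ j, 1 ≤ b j)
    (hts : 2 ≤ t + s) :
    IsDiagonalOrder (simplePolynomial d e)
      (Nat.lcm (Finset.univ.lcm fun i => kleinNumber d (a i))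
        (Finset.univ.lcm fun j => (d - 1) ^ (b j - 1))) := by
  refine IsDiagonalOrder.lcm (IsDiagonalOrder.finset_lcm _ _ fun i₀ _ => ?_)
    (IsDiagonalOrder.finset_lcm _ _ fun j₀ _ => isDiagonalOrder_pow (by omega) j₀ (hb j₀))
  rcases Nat.eq_zero_or_pos s with hs | hs
  · obtain ⟨i₁, hi₁⟩ : ∃ i₁, i₁ ≠ i₀ :=
      haveI : Nontrivial (Fin t) := Fin.nontrivial_iff_two_le.mpr (by omega)
      exists_ne i₀
    refine isDiagonalOrder_kleinNumber hd i₀ (ha i₀) (Sum.inl ⟨i₁, ⟨0, ha i₁⟩⟩) fun k hk => hi₁ ?_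
    exact congrArg Sigma.fst (Sum.inl.inj hk)
  · exact isDiagonalOrder_kleinNumber hd i₀ (ha i₀) (Sum.inr ⟨⟨0, hs⟩, ⟨0, hb _⟩⟩) (by simp)

end Simple

/-- Every number described by `IsMaximalOrder` divides the order of a diagonal symmetry of a simple
polynomial; variables left over are filled in by components `x ^ d`. -/
theorem IsMaximalOrder.exists_isDiagonalOrder {d N X : ℕ} (hd : 3 ≤ d) (hN : 2 ≤ N)
    (hX : IsMaximalOrder d N X) :
    ∃ (F : MvPolynomial (Fin N) ℂ) (Y : ℕ), IsSimpleWithAtMostOneT d F ∧ X ∣ Y ∧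
      IsDiagonalOrder F Y := by
  have hfill : ∀ {t : ℕ} (a : Fin t → ℕ), (∀ i, 1 ≤ a i) → ∑ i, a i ≤ N →
      2 ≤ t + (N - ∑ i, a i) → ∃ (F : MvPolynomial (Fin N) ℂ) (Y : ℕ),
      IsSimpleWithAtMostOneT d F ∧ (Finset.univ.lcm fun i => kleinNumber d (a i)) ∣ Y ∧
        IsDiagonalOrder F Y := by
    intro t a ha hsum hts
    obtain ⟨e⟩ := exists_variable_distribution (N := N) (a := a)
      (b := fun _ : Fin (N - ∑ i, a i) => 1) (by simp; omega)
    exact ⟨simplePolynomial d e, _, isSimpleWithAtMostOneT_simplePolynomial ha (by simp) (by simp),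
      Nat.dvd_lcm_left _ _, isDiagonalOrder_lcm hd ha (by simp) hts⟩
  rcases hX with rfl | rfl | ⟨a, ha1, haN, rfl⟩ | ⟨t, a, ht, -, ha, hsum, rfl⟩ |
    ⟨t, a, b, ht, -, ha, hb, hsum, rfl⟩
  · obtain ⟨e⟩ := exists_variable_distribution (N := N) (a := fun _ : Fin 1 => N)
      (b := fun j : Fin 0 => j.elim0) (by simp)
    refine ⟨simplePolynomial d e, _, isSimpleWithAtMostOneT_simplePolynomial (fun _ => by omega)
      (fun j => j.elim0) fun j => j.elim0, dvd_rfl,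
      isDiagonalOrder_kleinNumber_div (a := fun _ : Fin 1 => N) hd 0 hN ?_⟩
    rintro (⟨i, k⟩ | ⟨j, k⟩)
    · obtain rfl : i = 0 := Subsingleton.elim _ _
      exact ⟨k, rfl⟩
    · exact j.elim0
  · obtain ⟨e⟩ := exists_variable_distribution (N := N) (a := fun j : Fin 0 => j.elim0)
      (b := fun _ : Fin 1 => N) (by simp)
    exact ⟨simplePolynomial d e, _, isSimpleWithAtMostOneT_simplePolynomial (fun j => j.elim0)
      (fun _ => by omega) fun j j' _ _ => Subsingleton.elim _ _, dvd_rfl,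
      isDiagonalOrder_pow (b := fun _ : Fin 1 => N) (by omega) 0 (by omega)⟩
  · obtain ⟨F, Y, hF, hY, hFY⟩ := hfill (fun _ : Fin 1 => a) (fun _ => ha1) (by simp; omega)
      (by simp; omega)
    exact ⟨F, Y, hF, (Finset.dvd_lcm (f := fun _ : Fin 1 => kleinNumber d a)
      (Finset.mem_univ 0)).trans hY, hFY⟩
  · exact hfill a ha hsum (by omega)
  · obtain ⟨e⟩ := exists_variable_distribution (N := N) (a := a)
      (b := Fin.cons b fun _ : Fin (N - ∑ i, a i - b) => 1) (by simp [Fin.sum_univ_succ]; omega)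
    have hb1 : ∀ j, 1 ≤ (Fin.cons b fun _ => 1 : Fin (N - ∑ i, a i - b + 1) → ℕ) j := by
      intro j
      cases j using Fin.cases <;> simp; omega
    refine ⟨simplePolynomial d e, _, isSimpleWithAtMostOneT_simplePolynomial ha hb1 ?_,
      ?_, isDiagonalOrder_lcm hd ha hb1 (by omega)⟩
    · intro j j'
      cases j using Fin.cases <;> cases j' using Fin.cases <;> simp
    · refine lcm_dvd_lcm (dvd_refl (Finset.univ.lcm fun i => kleinNumber d (a i))) ?_
      exact Finset.dvd_lcm (f := fun j => (d - 1) ^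
        ((Fin.cons b fun _ => 1 : Fin (N - ∑ i, a i - b + 1) → ℕ) j - 1)) (Finset.mem_univ 0)

end SimpleHypersurface

theorem theorem4p8 (d N : ℕ) (hd : 3 ≤ d) (hN : 3 ≤ N)
    (F : MvPolynomial (Fin N) ℂ) (hF : SimpleHypersurface.IsSmoothForm d F)
    (g : Matrix.ProjGenLinGroup (Fin N) ℂ) (hg : g ∈ SimpleHypersurface.Lin F)
    (n : ℕ) (hn : orderOf g = n) :
    (∃ F₀ : MvPolynomial (Fin N) ℂ, SimpleHypersurface.IsSimpleWithAtMostOneT d F₀ ∧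
      ∃ h ∈ SimpleHypersurface.Lin F₀, orderOf h = n) ∧
    (n ∣ SimpleHypersurface.kleinNumber d N / d ∨
      n ∣ (d - 1) ^ (N - 1) ∨
      (∃ a : ℕ, 1 ≤ a ∧ a ≤ N - 1 ∧ n ∣ SimpleHypersurface.kleinNumber d a) ∨
      (∃ (t : ℕ) (a : Fin t → ℕ), 2 ≤ t ∧ StrictMono a ∧ (∀ i, 1 ≤ a i) ∧ ∑ i, a i ≤ N ∧
        n ∣ Finset.univ.lcm fun i => SimpleHypersurface.kleinNumber d (a i)) ∨
      (∃ (t : ℕ) (a : Fin t → ℕ) (b : ℕ), 1 ≤ t ∧ StrictMono a ∧ (∀ i, 1 ≤ a i) ∧ 2 ≤ b ∧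
        (∑ i, a i) + b ≤ N ∧
        n ∣ Nat.lcm (Finset.univ.lcm fun i => SimpleHypersurface.kleinNumber d (a i))
          ((d - 1) ^ (b - 1)))) := by
  obtain ⟨X, hX, hnX⟩ := hF.exists_orderOf_dvd hd (by omega) hg
  rw [hn] at hnX
  refine ⟨?_, ?_⟩
  · obtain ⟨F₀, Y, hF₀, hXY, hY⟩ := hX.exists_isDiagonalOrder hd (by omega)
    exact ⟨F₀, hF₀, hY.exists_mem_Lin (hnX.trans hXY)⟩
  · rcases hX with rfl | rfl | ⟨a, ha1, haN, rfl⟩ | ⟨t, a, ht, hm, ha, hsum, rfl⟩ |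
      ⟨t, a, b, ht, hm, ha, hb, hsum, rfl⟩
    · exact Or.inl hnX
    · exact Or.inr (Or.inl hnX)
    · exact Or.inr (Or.inr (Or.inl ⟨a, ha1, haN, hnX⟩))
    · exact Or.inr (Or.inr (Or.inr (Or.inl ⟨t, a, ht, hm, ha, hsum, hnX⟩)))
    · exact Or.inr (Or.inr (Or.inr (Or.inr ⟨t, a, b, ht, hm, ha, hb, hsum, hnX⟩)))
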